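/- Let $X$ be a Hausdorff topological space. An $\omega$-cover of $X$ is an open cover $\mathcal U$ of $X$ such that $X\notin\mathcal U$ and every finite subset of $X$ is contained in some member of $\mathcal U$. Let $\mathcal O$ be the family of all open covers of $X$ and $\Omega$ the family of all $\omega$-covers of $X$. For a set $S$ write $[S]^m$, $[S]^{<\aleph_0}$, $[S]^{\aleph_0}$ for the families of its $m$-element, finite, and countably infinite subsets. Given a countably infinite set $A$ with a bijective enumeration $(a_n)_{n\in\mathbb N}$, and $s,T\subseteq A$, write $s<T$ if $n<m$ whenever $a_n\in s$ and $a_m\in T$; in particular $\emptyset<T$. For finite $s\subseteq A$ and $S\subseteq A$ put $S|s=\{x\in S: s<\{x\}\}$. A set $s\subseteq D$ is an initial segment of $D\subseteq A$ if $s<D\setminus s$. For $B\subseteq A$ put $[s,B]=\{s\cup C\in[A]^{\aleph_0}: s<C\subseteq B\}$. The Ellentuck topology on $[A]^{\aleph_0}$ has as a basis the sets $[s,B]$ with $s\subseteq A$ finite, $B\in[A]^{\aleph_0}$ and $s<B$; subsets of $[A]^{\aleph_0}$ carry the subspace topology. A subset of a topological space has the Baire property if it is the symmetric difference of an open set and a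 meager set. Suppose that every $\omega$-cover of $X$ has a countable subset that is an $\omega$-cover of $X$. Then the following eleven statements are equivalent. 1. $\mathsf S_1(\Omega,\Omega)$: for every sequence $(\mathcal U_n)_{n\in\mathbb N}$ in $\Omega$ there are $U_n\in\mathcal U_n$ ($n\in\mathbb N$) with $\{U_n:n\in\mathbb N\}\in\Omega$. 2. $\mathsf E(\Omega,\Omega)$: for every countably infinite $A\in\Omega$, every bijective enumeration of $A$, and every $R\subseteq[A]^{\aleph_0}\cap\Omega$ that has the Baire property in the Ellentuck topology on $[A]^{\aleph_0}\cap\Omega$: for each $S\subseteq A$ with $S\in\Omega$ and each finite $s\subseteq A$ there is an infinite $B\subseteq S|s$ with $B\in\Omega$ such that $[s,B]\cap\Omega\subseteq R$ or $[s,B]\cap\Omega\cap R=\emptyset$. 3. $\mathsf{GP}(\Omega,\Omega)$: for every countably infinite $A\in\Omega$ and every $R\subseteq[A]^{\aleph_0}\cap\Omega$ that is open in the topology on $[A]^{\aleph_0}\cap\Omega$ inherited from the product space $2^A$ via characteristic functions: for each $S\in[A]^{\aleph_0}\cap\Omega$ there is $B\in[S]^{\aleph_0}\cap\Omega$ such that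 $[B]^{\aleph_0}\cap\Omega\subseteq R$ or $[B]^{\aleph_0}\cap\Omega\cap R=\emptyset$. 4. $\mathsf{FG}(\Omega,\Omega)$: for every countably infinite $A\in\Omega$, every bijective enumeration of $A$, and every $\mathcal S\subseteq[A]^{<\aleph_0}$ such that $\mathcal S\cap[B]^{<\aleph_0}\neq\emptyset$ for all $B\in[A]^{\aleph_0}\cap\Omega$, there is $B\in[A]^{\aleph_0}\cap\Omega$ such that each $C\in[B]^{\aleph_0}\cap\Omega$ has an initial segment in $\mathcal S$. 5. $\mathsf{NW}(\Omega,\Omega)$: for every countably infinite $A\in\Omega$, every bijective enumeration of $A$, every $\mathcal T\subseteq[A]^{<\aleph_0}$ such that no element of $\mathcal T$ is an initial segment of another one, every $n\ge1$, and every partition $\mathcal T=\mathcal T_1\cup\dots\cup\mathcal T_n$ into pairwise disjoint (possibly empty) parts, there are $B\in[A]^{\aleph_0}\cap\Omega$ and $i\in\{1,\dots,n\}$ with $[B]^{<\aleph_0}\cap\mathcal T\subseteq\mathcal T_i$. 6. $\Omega\to(\Omega)^n_k$ for all $n,k\ge1$: for each $A\in\Omega$ and $f:[A]^n\to\{1,\dots,k\}$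 there is $B\subseteq A$ with $B\in\Omega$ such that $f$ is constant on $[B]^n$. 7. $\Omega\to[\Omega]^n_{k/\le2}$ for all $n,k\ge1$: for each $A\in\Omega$ and $f:[A]^n\to\{1,\dots,k\}$ there is $B\subseteq A$ with $B\in\Omega$ such that $f$ takes at most two values on $[B]^n$. 8. $\Omega\to[\Omega]^2_3$: for each $A\in\Omega$ and $f:[A]^2\to\{1,2,3\}$ there is $B\subseteq A$ with $B\in\Omega$ such that $f$ takes at most two values on $[B]^2$. 9. $\Omega\to(\Omega,4)^3$: for each $A\in\Omega$ and $f:[A]^3\to\{1,2\}$, either there is $B\subseteq A$ with $B\in\Omega$ and $f\equiv1$ on $[B]^3$, or there is a four-element $B\subseteq A$ with $f\equiv2$ on $[B]^3$. 10. $\Omega\to(\Omega)^2_2$, i.e. the case $n=k=2$ of the relation in 6. 11. $\Omega\to(\Omega,\mathcal O)^2$: for each $A\in\Omega$ and $f:[A]^2\to\{1,2\}$, either there is $B\subseteq A$ with $B\in\Omega$ and $f\equiv1$ on $[B]^2$, or there is $B\subseteq A$ with $B\in\mathcal O$ and $f\equiv2$ on $[B]^2$. -/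

import Mathlib

open Set

namespace RamseyCovers

section Families

variable {α : Type*}

/-- `[S]^{ℵ₀}`: the countably infinite subsets of `S`. -/
def infSubsets (S : Set α) : Set (Set α) := {B | B ⊆ S ∧ B.Countable ∧ B.Infinite}

/-- `[S]^{<ℵ₀}`: the finite subsets of `S`. -/
def finSubsets (S : Set α) : Set (Set α) := {s | s ⊆ S ∧ s.Finite}

/-- `[S]^m`: the `m`-element subsets of `S`. -/
def cardSubsets (S : Set α) (m : ℕ) : Set (Finset α) := {s | (s : Set α) ⊆ S ∧ s.card = m}

/-- The selection principle `S₁(𝒜, ℬ)`. -/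
def S1 (𝒜 ℬ : Set (Set α)) : Prop :=
  ∀ O : ℕ → Set α, (∀ n, O n ∈ 𝒜) → ∃ T : ℕ → α, (∀ n, T n ∈ O n) ∧ range T ∈ ℬ

/-- `s < T` with respect to the enumeration `(a n)`: every term of `s` comes before every
term of `T`. It holds vacuously if `s` or `T` is empty. -/
def Precedes (a : ℕ → α) (s T : Set α) : Prop :=
  ∀ n m, a n ∈ s → a m ∈ T → n < m

/-- `B|s`: the elements of `B` that come after all elements of `s`. -/
def after (a : ℕ → α) (B s : Set α) : Set α := {x ∈ B | Precedes a s {x}}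

/-- The set `[s, B]`, where `A = range a`. -/
def ellentuckBasic (a : ℕ → α) (s B : Set α) : Set (Set α) :=
  {D | D ∈ infSubsets (range a) ∧ ∃ C, Precedes a s C ∧ C ⊆ B ∧ D = s ∪ C}

/-- The Ellentuck topology on `[A]^{ℵ₀}`, where `A = range a`: the topology with the sets `[s, B]`
(`s ⊆ A` finite, `B ∈ [A]^{ℵ₀}`, `s < B`) as basis. -/
@[reducible] def ellentuckTopology (a : ℕ → α) : TopologicalSpace (infSubsets (range a)) :=
  TopologicalSpace.generateFrom
    {V | ∃ s ∈ finSubsets (range a), ∃ B ∈ infSubsets (range a), Precedes a s B ∧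
      V = Subtype.val ⁻¹' ellentuckBasic a s B}

/-- The subspace topology on `[A]^{ℵ₀} ∩ ℬ` inherited from the Ellentuck topology. -/
@[reducible] def ellentuckSubspace (a : ℕ → α) (ℬ : Set (Set α)) :
    TopologicalSpace (infSubsets (range a) ∩ ℬ : Set (Set α)) :=
  TopologicalSpace.induced (Set.inclusion inter_subset_left) (ellentuckTopology a)

/-- The Baire property: the symmetric difference of an open set and a meager set. -/
def HasBaireProperty {Y : Type*} (t : TopologicalSpace Y) (R : Set Y) : Prop :=
  ∃ U M : Set Y, @IsOpen Y t U ∧ @IsMeagre Y t M ∧ R = (U \ M) ∪ (M \ U)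

/-- The statement `E(𝒜, ℬ)`. A set is countably infinite iff it has a bijective enumeration; the
statement is about every such enumeration `(a n)` of `A`. -/
def EllentuckStatement (𝒜 ℬ : Set (Set α)) : Prop :=
  ∀ A ∈ 𝒜, ∀ a : ℕ → α, Function.Injective a → range a = A →
    ∀ R : Set (Set α), R ⊆ infSubsets (range a) ∩ ℬ →
      HasBaireProperty (ellentuckSubspace a ℬ) (Subtype.val ⁻¹' R) →
      ∀ S ⊆ A, S ∈ 𝒜 → ∀ s ∈ finSubsets A,
        ∃ B ⊆ after a S s, B.Infinite ∧ B ∈ ℬ ∧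
          (ellentuckBasic a s B ∩ ℬ ⊆ R ∨ ellentuckBasic a s B ∩ ℬ ∩ R = ∅)

open Classical in
/-- The characteristic function of `D`, as a point of `2^A`. -/
noncomputable def charFun (A D : Set α) : A → Bool := fun x => decide ((x : α) ∈ D)

/-- The topology on `[A]^{ℵ₀} ∩ ℬ` inherited from the product topology of `2^A` (with discrete
two-point factors) by identifying sets with their characteristic functions. -/
@[reducible] noncomputable def cantorSubspace (A : Set α) (ℬ : Set (Set α)) :
    TopologicalSpace (infSubsets A ∩ ℬ : Set (Set α)) :=
  TopologicalSpace.induced (fun D => charFun A (D : Set α)) Pi.topologicalSpace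

/-- The statement `GP(𝒜, ℬ)`. -/
def GalvinPrikryStatement (𝒜 ℬ : Set (Set α)) : Prop :=
  ∀ A ∈ 𝒜, A.Countable → A.Infinite →
    ∀ R : Set (Set α), R ⊆ infSubsets A ∩ ℬ →
      @IsOpen _ (cantorSubspace A ℬ) (Subtype.val ⁻¹' R) →
      ∀ S ∈ infSubsets A ∩ 𝒜, ∃ B ∈ infSubsets S ∩ ℬ,
        infSubsets B ∩ ℬ ⊆ R ∨ infSubsets B ∩ ℬ ∩ R = ∅

/-- `s` is an initial segment of `D` with respect to the enumeration `(a n)`. -/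
def IsInitialSegment (a : ℕ → α) (s D : Set α) : Prop := s ⊆ D ∧ Precedes a s (D \ s)

/-- `𝒮 ⊆ [A]^{<ℵ₀}` is dense (relative to `𝒜`). -/
def IsDenseFamily (𝒜 : Set (Set α)) (A : Set α) (𝒮 : Set (Set α)) : Prop :=
  ∀ B ∈ infSubsets A ∩ 𝒜, (𝒮 ∩ finSubsets B).Nonempty

/-- No element of `𝒯` is an initial segment of another element of `𝒯`. -/
def IsThinFamily (a : ℕ → α) (𝒯 : Set (Set α)) : Prop :=
  ∀ s ∈ 𝒯, ∀ t ∈ 𝒯, s ≠ t → ¬ IsInitialSegment a s t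

/-- The statement `FG(𝒜, ℬ)`. -/
def GalvinStatement (𝒜 ℬ : Set (Set α)) : Prop :=
  ∀ A ∈ 𝒜, ∀ a : ℕ → α, Function.Injective a → range a = A →
    ∀ 𝒮 ⊆ finSubsets A, IsDenseFamily 𝒜 A 𝒮 →
      ∃ B ∈ infSubsets A ∩ ℬ, ∀ C ∈ infSubsets B ∩ ℬ, ∃ s ∈ 𝒮, IsInitialSegment a s C

/-- The statement `NW(𝒜, ℬ)`. The parts of a partition may be empty. -/
def NashWilliamsStatement (𝒜 ℬ : Set (Set α)) : Prop :=
  ∀ A ∈ 𝒜, ∀ a : ℕ → α, Function.Injective a → range a = A →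
    ∀ 𝒯 ⊆ finSubsets A, IsThinFamily a 𝒯 →
      ∀ n : ℕ, 1 ≤ n → ∀ P : Fin n → Set (Set α),
        Pairwise (fun i j => Disjoint (P i) (P j)) → 𝒯 = ⋃ i, P i →
        ∃ B ∈ infSubsets A ∩ ℬ, ∃ i, finSubsets B ∩ 𝒯 ⊆ P i

/-- The partition relation `𝒜 → (ℬ₁, …, ℬₖ)^m`. -/
def Arrow {k : ℕ} (𝒜 : Set (Set α)) (ℬ : Fin k → Set (Set α)) (m : ℕ) : Prop :=
  ∀ A ∈ 𝒜, ∀ f : cardSubsets A m → Fin k,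
    ∃ i, ∃ B ⊆ A, B ∈ ℬ i ∧ ∀ s : cardSubsets A m, ((s : Finset α) : Set α) ⊆ B → f s = i

/-- The square bracket partition relation `𝒜 → [ℬ]^m_{k/≤ℓ}`. -/
def SquareArrow (𝒜 ℬ : Set (Set α)) (m k ℓ : ℕ) : Prop :=
  ∀ A ∈ 𝒜, ∀ f : cardSubsets A m → Fin k,
    ∃ B ⊆ A, B ∈ ℬ ∧
      (f '' {s : cardSubsets A m | ((s : Finset α) : Set α) ⊆ B}).ncard ≤ ℓ

/-- The family of all sets with exactly `c` elements. -/
def setsOfCard (α : Type*) (c : ℕ) : Set (Set α) := {B | B.Finite ∧ B.ncard = c}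

end Families

/-- The family `𝒪` of open covers of `X`. -/
def openCovers (X : Type*) [TopologicalSpace X] : Set (Set (Set X)) :=
  {𝒰 | (∀ U ∈ 𝒰, IsOpen U) ∧ ⋃₀ 𝒰 = univ}

/-- The family `Ω` of (open) `ω`-covers of `X`. -/
def omegaCovers (X : Type*) [TopologicalSpace X] : Set (Set (Set X)) :=
  {𝒰 | 𝒰 ∈ openCovers X ∧ univ ∉ 𝒰 ∧ ∀ F : Set X, F.Finite → ∃ U ∈ 𝒰, F ⊆ U}

end RamseyCovers

open RamseyCovers

/-! Fix an enumeration `a` of a countable `ω`-cover and pass to index sets: let `H` consist of all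
`I ⊆ ℕ` with `a '' I` an `ω`-cover. Splitting an `ω`-cover in two leaves an `ω`-cover on one side,
and finite families are never `ω`-covers, so `H` is a coideal. The heart of the forward direction is
that `S₁(Ω, Ω)` makes `H` selective (`isSelectiveCoideal_indexFamily`). Ellentuck's argument then
works relative to `H`: diagonalization gives a fusion lemma, accepting and rejecting handle open
families (`ramsey_of_open`), and another fusion handles countable unions of null families
(`null_iUnion`). Together they settle all families with the Baire property. The Galvin–Prikry
statement is a special case. Applied to the open family of covers with an initial segment in a given
family, it yields the Galvin and Nash-Williams statements. These give Ramsey relations, since sets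
of equal finite size are not proper initial segments of one another. Conversely, each weak partition
relation recovers `S₁(Ω, Ω)` from a colouring of a stratified cover `{w n ∩ U : U ∈ O n}`, where
`range w` is an `ω`-cover. Colours compare the stratum indices. No single `w n` equals `X`, so a
cover cannot live in one stratum, and homogeneity forces essentially one choice from each `O n`. -/

namespace RamseyCovers

/-! ### Ellentuck theory relative to a selective coideal -/

/-- A selective coideal on `ℕ`: a coideal of infinite sets in which every decreasing sequence has
a diagonalization. -/
structure IsSelectiveCoideal (H : Set (Set ℕ)) : Prop where
  mono : ∀ I ∈ H, ∀ J, I ⊆ J → J ∈ H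
  union : ∀ I J, I ∪ J ∈ H → I ∈ H ∨ J ∈ H
  infinite : ∀ I ∈ H, I.Infinite
  diag : ∀ D : ℕ → Set ℕ, Antitone D → (∀ n, D n ∈ H) →
    ∃ C ∈ H, C ⊆ D 0 ∧ ∀ n ∈ C, C ∩ Ioi n ⊆ D (n + 1)

/-- The numbers above all elements of `t`. -/
def above (t : Finset ℕ) : Set ℕ := {j | ∀ i ∈ t, i < j}

/-- The basic set `[s, B]` relative to a family `H` of sets of natural numbers. -/
def natBasic (H : Set (Set ℕ)) (s : Finset ℕ) (B : Set ℕ) : Set (Set ℕ) :=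
  {D ∈ H | (s : Set ℕ) ⊆ D ∧ ∀ j ∈ D, j ∉ s → j ∈ B ∧ j ∈ above s}

theorem finite_compl_above (t : Finset ℕ) : (above t)ᶜ.Finite := by
  refine (finite_Iic (t.sup id)).subset fun j hj => ?_
  simp only [above, mem_compl_iff, mem_ofPred_eq, not_forall, not_lt] at hj
  obtain ⟨i, hi, hij⟩ := hj
  exact hij.trans (Finset.le_sup (f := id) hi)

theorem natBasic_mono {H : Set (Set ℕ)} {s : Finset ℕ} {B B' : Set ℕ} (h : B ⊆ B') :
    natBasic H s B ⊆ natBasic H s B' :=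
  fun _ hD => ⟨hD.1, hD.2.1, fun j hj hjs => ⟨h (hD.2.2 j hj hjs).1, (hD.2.2 j hj hjs).2⟩⟩

/-- New elements of a member of `[s, B]` lie above `s`, hence above `t`. This removes the
restriction to `above t` that fusion leaves behind. -/
theorem natBasic_inter_above {H : Set (Set ℕ)} {s t : Finset ℕ} (h : t ⊆ s) (B : Set ℕ) :
    natBasic H s B ⊆ natBasic H s (B ∩ above t) :=
  fun _ hD => ⟨hD.1, hD.2.1, fun j hj hjs =>
    ⟨⟨(hD.2.2 j hj hjs).1, fun i hi => (hD.2.2 j hj hjs).2 i (h hi)⟩, (hD.2.2 j hj hjs).2⟩⟩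

namespace IsSelectiveCoideal

variable {H : Set (Set ℕ)} (hH : IsSelectiveCoideal H)

include hH

theorem inter_mem {I F : Set ℕ} (hI : I ∈ H) (hF : Fᶜ.Finite) : I ∩ F ∈ H := by
  rw [← inter_union_compl I F] at hI
  rcases hH.union _ _ hI with h | h
  · exact h
  · exact absurd (hF.subset inter_subset_right) (hH.infinite _ h)

/-- Fusion: dense hereditary conditions `P t` can be met for all finite subsets `t` of one set. -/
theorem fusion (P : Finset ℕ → Set ℕ → Prop) {S : Set ℕ} (hS : S ∈ H)
    (hered : ∀ t, ∀ B B', B' ⊆ B → P t B → P t B')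
    (dense : ∀ t : Finset ℕ, (t : Set ℕ) ⊆ S → ∀ B ∈ H, B ⊆ S → ∃ B' ∈ H, B' ⊆ B ∧ P t B') :
    ∃ C ∈ H, C ⊆ S ∧ ∀ t : Finset ℕ, (t : Set ℕ) ⊆ C → P t (C ∩ above t) := by
  have many : ∀ (𝒯 : Finset (Finset ℕ)), ∀ B ∈ H, B ⊆ S → ∃ B' ∈ H, B' ⊆ B ∧
      ∀ t ∈ 𝒯, (t : Set ℕ) ⊆ S → P t B' := by
    intro 𝒯
    induction 𝒯 using Finset.induction_on with
    | empty => exact fun B hB _ => ⟨B, hB, Subset.rfl, by simp⟩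
    | insert t 𝒯 _ ih =>
      intro B hB hBS
      obtain ⟨B₁, hB₁, hs₁, h₁⟩ := ih B hB hBS
      by_cases ht : (t : Set ℕ) ⊆ S
      · obtain ⟨B₂, hB₂, hs₂, h₂⟩ := dense t ht B₁ hB₁ (hs₁.trans hBS)
        refine ⟨B₂, hB₂, hs₂.trans hs₁, fun u hu huS => ?_⟩
        rcases Finset.mem_insert.1 hu with rfl | hu
        · exact h₂
        · exact hered u _ _ hs₂ (h₁ u hu huS)
      · refine ⟨B₁, hB₁, hs₁, fun u hu huS => ?_⟩
        rcases Finset.mem_insert.1 hu with rfl | hu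
        · exact absurd huS ht
        · exact h₁ u hu huS
  have step : ∀ (n : ℕ) (B : {B : Set ℕ // B ∈ H ∧ B ⊆ S}),
      ∃ B' : {B : Set ℕ // B ∈ H ∧ B ⊆ S}, B'.1 ⊆ B.1 ∧
        ∀ t ∈ (Finset.range n).powerset, (t : Set ℕ) ⊆ S → P t B'.1 := by
    rintro n ⟨B, hB, hBS⟩
    obtain ⟨B', h₁, h₂, h₃⟩ := many (Finset.range n).powerset B hB hBS
    exact ⟨⟨B', h₁, h₂.trans hBS⟩, h₂, h₃⟩
  choose next hnext hP using step
  -- `D n` meets the conditions for all `t` with elements below `n`. If `m = max t`, the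
  -- diagonalization puts `C ∩ above t` inside `D (m + 1)`, and `m + 1` is just large enough to
  -- cover `t`.
  let D : ℕ → {B : Set ℕ // B ∈ H ∧ B ⊆ S} :=
    fun n => Nat.rec (next 0 ⟨S, hS, Subset.rfl⟩) (fun n B => next (n + 1) B) n
  have hDP : ∀ n, ∀ t ∈ (Finset.range n).powerset, (t : Set ℕ) ⊆ S → P t (D n).1 := by
    intro n
    cases n with
    | zero => exact hP 0 _
    | succ n => exact hP (n + 1) _
  obtain ⟨C, hC, hC0, hCD⟩ := hH.diag (fun n => (D n).1)
    (antitone_nat_of_succ_le fun n => hnext (n + 1) (D n)) (fun n => (D n).2.1)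
  have hCS : C ⊆ S := hC0.trans (D 0).2.2
  refine ⟨C, hC, hCS, fun t ht => ?_⟩
  rcases t.eq_empty_or_nonempty with rfl | hne
  · exact hered _ _ _ (inter_subset_left.trans hC0) (hDP 0 ∅ (by simp) (by simp))
  · have hmax := t.max'_mem hne
    refine hered t _ _ (fun j hj => ?_) (hDP (t.max' hne + 1) t ?_ (ht.trans hCS))
    · exact hCD _ (ht hmax) ⟨hj.1, hj.2 _ hmax⟩
    · rw [Finset.mem_powerset]
      intro i hi
      exact Finset.mem_range.2 (Nat.lt_succ_of_le (t.le_max' i hi))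

/-- The first number outside `s` of a member of `[s, B]` extends `s`. -/
theorem exists_next {s : Finset ℕ} {B D : Set ℕ} (hD : D ∈ natBasic H s B) :
    ∃ x ∈ D, x ∉ s ∧ ∀ j ∈ D, j ∉ s → j ≠ x → x < j := by
  have hne : (D \ s).Nonempty := ((hH.infinite D hD.1).sdiff s.finite_toSet).nonempty
  have hmem := WellFounded.min_mem wellFounded_lt (D \ (s : Set ℕ)) hne
  refine ⟨_, hmem.1, by simpa using hmem.2, fun j hj hjs hne' => ?_⟩
  refine lt_of_le_of_ne (not_lt.1 ?_) (Ne.symm hne')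
  exact WellFounded.not_lt_min wellFounded_lt (D \ (s : Set ℕ)) ⟨hj, by simpa using hjs⟩

/-- Open families are completely Ramsey relative to a selective coideal. -/
theorem ramsey_of_open {R : Set (Set ℕ)}
    (hR : ∀ D ∈ R, ∃ m, ∀ D' ∈ H, D' ⊆ D → (∀ n < m, n ∈ D → n ∈ D') → D' ∈ R)
    (s : Finset ℕ) {S : Set ℕ} (hS : S ∈ H) :
    ∃ B ∈ H, B ⊆ S ∩ above s ∧ (natBasic H s B ⊆ R ∨ natBasic H s B ∩ R = ∅) := by
  classical
  -- `B` accepts `u` if all of `[u, B]` lies in `R`, and rejects `u` if no member of `H` inside `B`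
  -- accepts it. Both pass to smaller sets, and some smaller set always does one or the other.
  let acc : Finset ℕ → Set ℕ → Prop := fun u B => natBasic H u B ⊆ R
  let rej : Finset ℕ → Set ℕ → Prop := fun u B => ∀ C ∈ H, C ⊆ B → ¬ acc u C
  have acc_mono : ∀ u B B', B' ⊆ B → acc u B → acc u B' :=
    fun u B B' h hB => (natBasic_mono h).trans hB
  have rej_mono : ∀ u B B', B' ⊆ B → rej u B → rej u B' :=
    fun u B B' h hB C hC hCB => hB C hC (hCB.trans h)
  obtain ⟨C₁, hC₁, hC₁S, h₁⟩ := hH.fusion (fun t B => acc (s ∪ t) B ∨ rej (s ∪ t) B)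
    (hH.inter_mem hS (finite_compl_above s))
    (fun t B B' hB => Or.imp (acc_mono _ _ _ hB) (rej_mono _ _ _ hB))
    (fun t _ B hB _ => by
      by_cases h : rej (s ∪ t) B
      · exact ⟨B, hB, Subset.rfl, Or.inr h⟩
      · simp only [rej, not_forall, not_not] at h
        obtain ⟨C, hC, hCB, hacc⟩ := h
        exact ⟨C, hC, hCB, Or.inl hacc⟩)
  have decides : ∀ t : Finset ℕ, (t : Set ℕ) ⊆ C₁ → acc (s ∪ t) C₁ ∨ rej (s ∪ t) C₁ := by
    intro t ht
    rcases h₁ t ht with h | h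
    · exact Or.inl ((natBasic_inter_above Finset.subset_union_right _).trans h)
    · refine Or.inr fun C hC hCB hacc => ?_
      exact h (C ∩ above t) (hH.inter_mem hC (finite_compl_above t))
        (inter_subset_inter_left _ hCB) (acc_mono _ _ _ inter_subset_left hacc)
  by_cases hs : acc s C₁
  · exact ⟨C₁, hC₁, hC₁S, Or.inl hs⟩
  have hrej : rej (s ∪ ∅) C₁ := by
    refine (decides ∅ (by simp)).resolve_left ?_
    simpa using hs
  -- Second fusion: rejection of `s ∪ t` is to survive the addition of any later element of `C₂`.
  obtain ⟨C₂, hC₂, hC₂₁, h₂⟩ := hH.fusion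
    (fun t B => rej (s ∪ t) C₁ → ∀ x ∈ B, x ∈ above t → rej (s ∪ insert x t) C₁) hC₁
    (fun t B B' hB h hr x hx => h hr x (hB hx))
    (fun t ht B hB hBC => by
      by_cases hr : rej (s ∪ t) C₁
      swap
      · exact ⟨B, hB, Subset.rfl, fun h => absurd h hr⟩
      -- `Z` collects the extensions that are accepted. If `B ∩ Z` were in `H`, every member of `[s
      -- ∪ t, B ∩ Z]` would lie in `R` by way of its first new element, so `B ∩ Z` would accept `s ∪
      -- t`.
      let Z : Set ℕ := {x | x ∈ above t ∧ ¬ rej (s ∪ insert x t) C₁}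
      have hB' := hB
      rw [← inter_union_compl B Z] at hB'
      rcases hH.union _ _ hB' with hZ | hZ
      · refine absurd (fun D hD => ?_) (hr _ hZ (inter_subset_left.trans hBC))
        obtain ⟨x, hxD, hxs, hx⟩ := hH.exists_next hD
        obtain ⟨⟨hxB, hxt, hxr⟩, hxa⟩ := hD.2.2 x hxD hxs
        have hacc : acc (s ∪ insert x t) C₁ := (decides _ (by
          rw [Finset.coe_insert]
          exact insert_subset (hBC hxB) ht)).resolve_right hxr
        refine hacc ⟨hD.1, ?_, fun j hj hjs => ?_⟩
        · intro i hi
          have hi' : i ∈ s ∪ insert x t := hi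
          by_cases hix : i = x
          · rw [hix]; exact hxD
          · apply hD.2.1
            have : i ∈ s ∪ t := by
              simp only [Finset.mem_union, Finset.mem_insert] at hi' ⊢
              tauto
            exact this
        · have hjx : j ≠ x := by rintro rfl; simp at hjs
          have hjst : j ∉ s ∪ t := by
            simp only [Finset.mem_union, Finset.mem_insert] at hjs ⊢
            tauto
          obtain ⟨hjZ, hja⟩ := hD.2.2 j hj hjst
          refine ⟨hBC hjZ.1, fun i hi => ?_⟩
          by_cases hix : i = x
          · rw [hix]; exact hx j hj hjst hjx
          · apply hja
            simp only [Finset.mem_union, Finset.mem_insert] at hi ⊢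
            tauto
      · refine ⟨_, hZ, inter_subset_left, fun _ x hx hxt => ?_⟩
        by_contra hxr
        exact hx.2 ⟨hxt, hxr⟩)
  have allrej : ∀ t : Finset ℕ, (t : Set ℕ) ⊆ C₂ → rej (s ∪ t) C₁ := by
    intro t
    induction t using Finset.induction_on_max with
    | empty => exact fun _ => hrej
    | insert x t hx ih =>
      intro ht
      rw [Finset.coe_insert] at ht
      have ht' := (subset_insert _ _).trans ht
      exact h₂ t ht' (ih ht') x ⟨ht (mem_insert _ _), hx⟩ hx
  refine ⟨C₂, hC₂, hC₂₁.trans hC₁S, Or.inr ?_⟩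
  rw [eq_empty_iff_forall_notMem]
  rintro D ⟨hD, hDR⟩
  obtain ⟨m, hm⟩ := hR D hDR
  -- If `D ∈ R` were in `[s, C₂]`, openness would give a finite part `s ∪ t` of `D` that the rest of
  -- `D` accepts, although `C₁` rejects it.
  let t : Finset ℕ := (Finset.range (max m (s.sup id + 1))).filter (fun n => n ∈ D ∧ n ∉ s)
  have htC : (t : Set ℕ) ⊆ C₂ := by
    intro i hi
    have hi' := (Finset.mem_filter.1 (Finset.mem_coe.1 hi)).2
    exact (hD.2.2 i hi'.1 hi'.2).1
  have hDt : D ∩ ((s ∪ t : Finset ℕ) : Set ℕ)ᶜ ∈ H :=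
    hH.inter_mem hD.1 (by rw [compl_compl]; exact (s ∪ t).finite_toSet)
  refine allrej t htC _ hDt (fun j hj => ?_) (fun D' hD' => ?_)
  · refine hC₂₁ (hD.2.2 j hj.1 fun hjs => hj.2 ?_).1
    exact Finset.mem_coe.2 (Finset.mem_union_left _ hjs)
  · refine hm D' hD'.1 (fun j hj => ?_) (fun n hn hnD => hD'.2.1 ?_)
    · by_cases hjs : j ∈ s ∪ t
      · rcases Finset.mem_union.1 hjs with h | h
        · exact hD.2.1 h
        · exact (Finset.mem_filter.1 h).2.1
      · exact (hD'.2.2 j hj hjs).1.1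
    · by_cases hns : n ∈ s
      · exact Finset.mem_coe.2 (Finset.mem_union_left _ hns)
      · refine Finset.mem_coe.2 (Finset.mem_union_right _ (Finset.mem_filter.2 ⟨?_, hnD, hns⟩))
        exact Finset.mem_range.2 (hn.trans_le (le_max_left _ _))

/-- Countable unions of Ramsey null families are Ramsey null. -/
theorem null_iUnion {N : ℕ → Set (Set ℕ)}
    (hN : ∀ k, ∀ s : Finset ℕ, ∀ S ∈ H, ∃ B ∈ H, B ⊆ S ∧ natBasic H s B ∩ N k = ∅)
    (s : Finset ℕ) {S : Set ℕ} (hS : S ∈ H) :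
    ∃ B ∈ H, B ⊆ S ∧ natBasic H s B ∩ ⋃ k, N k = ∅ := by
  classical
  -- Each `t` deals only with the `N k` for `k ≤ max t`. This suffices: a member of `[s, C]` is
  -- infinite, so for a given `k` it also belongs to some `[s ∪ t, C ∩ above t]` with `max t > k`.
  obtain ⟨C, hC, hCS, hCP⟩ := hH.fusion
    (fun t B => ∀ k ∈ Finset.range (t.sup id + 1), natBasic H (s ∪ t) B ∩ N k = ∅) hS
    (fun t B B' hB h k hk => subset_empty_iff.1 <|
      (inter_subset_inter_left _ (natBasic_mono hB)).trans (h k hk).subset)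
    (fun t _ B hB _ => by
      induction Finset.range (t.sup id + 1) using Finset.induction_on with
      | empty => exact ⟨B, hB, Subset.rfl, by simp⟩
      | insert k K _ ih =>
        obtain ⟨B₁, hB₁, hs₁, h₁⟩ := ih
        obtain ⟨B₂, hB₂, hs₂, h₂⟩ := hN k (s ∪ t) B₁ hB₁
        refine ⟨B₂, hB₂, hs₂.trans hs₁, fun l hl => ?_⟩
        rcases Finset.mem_insert.1 hl with rfl | hl
        · exact h₂
        · exact subset_empty_iff.1 <|
            (inter_subset_inter_left _ (natBasic_mono hs₂)).trans (h₁ l hl).subset)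
  refine ⟨C, hC, hCS, ?_⟩
  rw [eq_empty_iff_forall_notMem]
  rintro D ⟨hD, hDN⟩
  obtain ⟨k, hk⟩ := mem_iUnion.1 hDN
  obtain ⟨n, ⟨hnD, hns⟩, hkn⟩ : ∃ n ∈ D \ (s : Set ℕ), k < n :=
    ((hH.infinite D hD.1).sdiff s.finite_toSet).exists_gt k
  let t : Finset ℕ := (Finset.range (n + 1)).filter (fun j => j ∈ D ∧ j ∉ s)
  have ht : ∀ j, j ∈ t ↔ j ≤ n ∧ j ∈ D ∧ j ∉ s := fun j => by
    simp [t, Finset.mem_filter]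
  have hnt : n ∈ t := (ht n).2 ⟨le_rfl, hnD, by simpa using hns⟩
  have htC : (t : Set ℕ) ⊆ C := fun i hi => by
    have hi' := (ht i).1 (Finset.mem_coe.1 hi)
    exact (hD.2.2 i hi'.2.1 hi'.2.2).1
  have hkt : k ∈ Finset.range (t.sup id + 1) := by
    rw [Finset.mem_range, Nat.lt_succ_iff]
    exact hkn.le.trans (Finset.le_sup (f := id) hnt)
  refine (eq_empty_iff_forall_notMem.1 (hCP t htC k hkt)) D ⟨⟨hD.1, ?_, ?_⟩, hk⟩
  · intro i hi
    rcases Finset.mem_union.1 (Finset.mem_coe.1 hi) with h | h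
    · exact hD.2.1 h
    · exact ((ht i).1 h).2.1
  · intro j hj hjst
    rw [Finset.mem_union, not_or] at hjst
    obtain ⟨hjC, hja⟩ := hD.2.2 j hj hjst.1
    have hnj : n < j := by
      by_contra hle
      exact hjst.2 ((ht j).2 ⟨not_lt.1 hle, hj, hjst.1⟩)
    have hjt : j ∈ above t := fun i hi => ((ht i).1 hi).1.trans_lt hnj
    refine ⟨⟨hjC, hjt⟩, fun i hi => ?_⟩
    rcases Finset.mem_union.1 hi with h | h
    · exact hja i h
    · exact hjt i h

end IsSelectiveCoideal

/-! ### The coideal of ω-covers and its selectivity -/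

section Omega

variable {X : Type*} [TopologicalSpace X]

theorem isOpen_of_mem_omegaCovers {𝒰 : Set (Set X)} (h : 𝒰 ∈ omegaCovers X) {U : Set X}
    (hU : U ∈ 𝒰) : IsOpen U := h.1.1 U hU

theorem ne_univ_of_mem_omegaCovers {𝒰 : Set (Set X)} (h : 𝒰 ∈ omegaCovers X) {U : Set X}
    (hU : U ∈ 𝒰) : U ≠ univ := fun e => h.2.1 (e ▸ hU)

theorem mem_omegaCovers {𝒰 : Set (Set X)} (ho : ∀ U ∈ 𝒰, IsOpen U) (hu : univ ∉ 𝒰)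
    (hF : ∀ F : Set X, F.Finite → ∃ U ∈ 𝒰, F ⊆ U) : 𝒰 ∈ omegaCovers X := by
  refine ⟨⟨ho, eq_univ_of_forall fun x => ?_⟩, hu, hF⟩
  obtain ⟨U, hU, hx⟩ := hF {x} (finite_singleton x)
  exact ⟨U, hU, hx rfl⟩

/-- A family of members of `ω`-covers that is refined by an `ω`-cover is an `ω`-cover. -/
theorem mem_omegaCovers_of_refine {𝒰 𝒱 : Set (Set X)} (h𝒱 : 𝒱 ∈ omegaCovers X)
    (h : ∀ U ∈ 𝒰, ∃ 𝒲 ∈ omegaCovers X, U ∈ 𝒲) (hr : ∀ V ∈ 𝒱, ∃ U ∈ 𝒰, V ⊆ U) :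
    𝒰 ∈ omegaCovers X := by
  refine mem_omegaCovers (fun U hU => ?_) (fun hU => ?_) (fun F hF => ?_)
  · obtain ⟨𝒲, h𝒲, hU⟩ := h U hU
    exact isOpen_of_mem_omegaCovers h𝒲 hU
  · obtain ⟨𝒲, h𝒲, hU⟩ := h _ hU
    exact h𝒲.2.1 hU
  · obtain ⟨V, hV, hFV⟩ := h𝒱.2.2 F hF
    obtain ⟨U, hU, hVU⟩ := hr V hV
    exact ⟨U, hU, hFV.trans hVU⟩

theorem omegaCovers_superset {𝒰 𝒱 𝒲 : Set (Set X)} (h𝒱 : 𝒱 ∈ omegaCovers X) (h : 𝒱 ⊆ 𝒰)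
    (h𝒲 : 𝒲 ∈ omegaCovers X) (h' : 𝒰 ⊆ 𝒲) : 𝒰 ∈ omegaCovers X :=
  mem_omegaCovers_of_refine h𝒱 (fun _ hU => ⟨𝒲, h𝒲, h' hU⟩) (fun V hV => ⟨V, h hV, Subset.rfl⟩)

/-- If a finite `F` lies in no member of one part and a finite `G` in no member of the other, then
`F ∪ G` lies in no member of the union. -/
theorem omegaCovers_union {𝒰 𝒱 : Set (Set X)} (h : 𝒰 ∪ 𝒱 ∈ omegaCovers X) :
    𝒰 ∈ omegaCovers X ∨ 𝒱 ∈ omegaCovers X := by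
  by_contra! hn
  have key : ∀ 𝒲 ⊆ 𝒰 ∪ 𝒱, 𝒲 ∉ omegaCovers X → ∃ F : Set X, F.Finite ∧ ∀ U ∈ 𝒲, ¬ F ⊆ U := by
    intro 𝒲 hs h𝒲
    by_contra! hF
    exact h𝒲 (mem_omegaCovers (fun U hU => isOpen_of_mem_omegaCovers h (hs hU))
      (fun hU => h.2.1 (hs hU)) hF)
  obtain ⟨F, hF, h₁⟩ := key 𝒰 subset_union_left hn.1
  obtain ⟨G, hG, h₂⟩ := key 𝒱 subset_union_right hn.2
  obtain ⟨U, hU, hFG⟩ := h.2.2 (F ∪ G) (hF.union hG)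
  rcases hU with hU | hU
  · exact h₁ U hU (subset_union_left.trans hFG)
  · exact h₂ U hU (subset_union_right.trans hFG)

/-- Finitely many sets other than `X` do not refine to an `ω`-cover. -/
theorem exists_not_subset_of_finite {𝒰 𝒱 : Set (Set X)} (h : 𝒰 ∈ omegaCovers X)
    (hf : 𝒱.Finite) (hu : univ ∉ 𝒱) : ∃ U ∈ 𝒰, ∀ V ∈ 𝒱, ¬ U ⊆ V := by
  classical
  have hx : ∀ V : Set X, ∃ F : Set X, F.Finite ∧ (V ∈ 𝒱 → ¬ F ⊆ V) := by
    intro V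
    by_cases hV : V ∈ 𝒱
    · obtain ⟨x, hx⟩ := (ne_univ_iff_exists_notMem V).1 (fun e => hu (e ▸ hV))
      exact ⟨{x}, finite_singleton x, fun _ hF => hx (hF rfl)⟩
    · exact ⟨∅, finite_empty, fun h => absurd h hV⟩
  choose F hF hFV using hx
  obtain ⟨U, hU, hUF⟩ := h.2.2 (⋃ V ∈ 𝒱, F V) (hf.biUnion fun V _ => hF V)
  exact ⟨U, hU, fun V hV hUV =>
    hFV V hV (((subset_biUnion_of_mem (u := F) hV).trans hUF).trans hUV)⟩

theorem infinite_of_mem_omegaCovers {𝒰 : Set (Set X)} (h : 𝒰 ∈ omegaCovers X) :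
    𝒰.Infinite := by
  intro hf
  obtain ⟨U, hU, hn⟩ := exists_not_subset_of_finite h hf h.2.1
  exact hn U hU Subset.rfl

theorem nonempty_of_mem_omegaCovers {𝒰 : Set (Set X)} (h : 𝒰 ∈ omegaCovers X) :
    Nonempty X := by
  obtain ⟨U, hU, -⟩ := h.2.2 ∅ finite_empty
  obtain ⟨x, -⟩ := (ne_univ_iff_exists_notMem U).1 (ne_univ_of_mem_omegaCovers h hU)
  exact ⟨x⟩

theorem omegaCovers_diff_finite {𝒰 𝒱 : Set (Set X)} (h : 𝒰 ∈ omegaCovers X)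
    (hf : 𝒱.Finite) : 𝒰 \ 𝒱 ∈ omegaCovers X := by
  have h' := h
  rw [← inter_union_sdiff 𝒰 𝒱] at h'
  rcases omegaCovers_union h' with h' | h'
  · exact absurd (hf.subset inter_subset_right) (infinite_of_mem_omegaCovers h')
  · exact h'

/-- The members of an `ω`-cover containing a given finite set form an infinite family. -/
theorem infinite_setOf_superset {𝒰 : Set (Set X)} (h : 𝒰 ∈ omegaCovers X) {F : Set X}
    (hF : F.Finite) : {U ∈ 𝒰 | F ⊆ U}.Infinite := by
  intro hf
  obtain ⟨U, hU, hFU⟩ := (omegaCovers_diff_finite h hf).2.2 F hF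
  exact hU.2 ⟨hU.1, hFU⟩

/-- If the choices from finite sets of growing size can be made far apart from each other with
respect to `r`, then they can be made `r`-independent. -/
theorem exists_independent_choice {α : Type*} (r : α → α → Prop) (s : ℕ → Finset α)
    (hcard : ∀ n, (s n).card = n + 1)
    (hfar : ∀ n w, ∀ u ∈ s n, ∀ v ∈ s n, r w u → r w v → u = v) :
    ∃ c : ℕ → α, (∀ n, c n ∈ s n) ∧ ∀ m n, m < n → ¬ r (c m) (c n) := by
  classical
  -- Pigeonhole: an earlier choice `w` is related to at most one of the `n + 1` candidates, so at
  -- most `n` earlier choices leave one candidate free. The size bound on `G` is a premise so that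
  -- `next` is defined for every `G`.
  have step : ∀ (n : ℕ) (G : Finset α), ∃ x ∈ s n, G.card ≤ n → ∀ w ∈ G, ¬ r w x := by
    intro n G
    by_cases hG : G.card ≤ n
    · by_contra! hcon
      have hcon' : ∀ x ∈ s n, ∃ w ∈ G, r w x := fun x hx => (hcon x hx).2
      choose! f hf hr using hcon'
      have := Finset.card_le_card_of_injOn f hf fun u hu v hv huv =>
        hfar n (f u) u hu v hv (hr u hu) (huv ▸ hr v hv)
      have := hcard n
      omega
    · have hne : (s n).Nonempty := Finset.card_pos.1 (by rw [hcard n]; omega)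
      obtain ⟨x, hx⟩ := hne
      exact ⟨x, hx, fun h => absurd h hG⟩
  choose next hmem hnext using step
  let G : ℕ → Finset α := fun n => Nat.rec ∅ (fun n G => insert (next n G) G) n
  have hGcard : ∀ n, (G n).card ≤ n := by
    intro n
    induction n with
    | zero => simp [G]
    | succ n ih => exact (Finset.card_insert_le _ _).trans (Nat.succ_le_succ ih)
  have hGmem : ∀ m n, m < n → next m (G m) ∈ G n := by
    intro m n h
    induction n, h using Nat.le_induction with
    | base => exact Finset.mem_insert_self _ _
    | succ n _ ih => exact Finset.mem_insert_of_mem ih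
  exact ⟨fun n => next n (G n), fun n => hmem n _,
    fun m n hmn => hnext n _ (hGcard n) _ (hGmem m n hmn)⟩

/-- Under `S₁(Ω, Ω)`, every `ω`-cover contains an independent `ω`-cover for every locally finite
relation on it. -/
theorem S1.exists_independent (h : S1 (omegaCovers X) (omegaCovers X)) {𝒰 : Set (Set X)}
    (h𝒰 : 𝒰 ∈ omegaCovers X) (r : Set X → Set X → Prop) (hsymm : ∀ U V, r U V → r V U)
    (hfin : ∀ U, {V | r U V}.Finite) :
    ∃ 𝒱 ⊆ 𝒰, 𝒱 ∈ omegaCovers X ∧ ∀ U ∈ 𝒱, ∀ V ∈ 𝒱, U ≠ V → ¬ r U V := by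
  classical
  let far : Finset (Set X) → Prop := fun s => ∀ w, ∀ u ∈ s, ∀ v ∈ s, r w u → r w v → u = v
  have hbig : ∀ F : Set X, F.Finite → ∀ n, ∃ s : Finset (Set X),
      (∀ U ∈ s, U ∈ 𝒰 ∧ F ⊆ U) ∧ s.card = n ∧ far s := by
    intro F hF n
    induction n with
    | zero => exact ⟨∅, by simp, rfl, fun w u hu => by simp at hu⟩
    | succ n ih =>
      obtain ⟨s, hs, hcard, hfar⟩ := ih
      -- A new member must avoid `s` and everything sharing an `r`-neighbour with an element of `s`.
      -- Local finiteness makes this a finite set.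
      have hbad : ((s : Set (Set X)) ∪ ⋃ u ∈ (s : Set (Set X)), ⋃ w ∈ {w | r u w},
          {v | r w v}).Finite :=
        s.finite_toSet.union (s.finite_toSet.biUnion fun u _ => (hfin u).biUnion fun w _ => hfin w)
      obtain ⟨U, hU, hUbad⟩ := ((infinite_setOf_superset h𝒰 hF).sdiff hbad).nonempty
      have hUs : U ∉ s := fun hs => hUbad (Or.inl hs)
      have hUr : ∀ u ∈ s, ∀ w, r w u → ¬ r w U := fun u hu w hwu hwU =>
        hUbad (Or.inr (mem_biUnion (Finset.mem_coe.2 hu) (mem_biUnion (hsymm _ _ hwu) hwU)))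
      refine ⟨insert U s, fun V hV => ?_, ?_, fun w u hu v hv hwu hwv => ?_⟩
      · rcases Finset.mem_insert.1 hV with rfl | hV
        · exact hU
        · exact hs V hV
      · rw [Finset.card_insert_of_notMem hUs, hcard]
      · rcases Finset.mem_insert.1 hu with hu | hu <;> rcases Finset.mem_insert.1 hv with hv | hv
        · rw [hu, hv]
        · exact absurd (hu ▸ hwu) (hUr v hv w hwv)
        · exact absurd (hv ▸ hwv) (hUr u hu w hwu)
        · exact hfar w u hu v hv hwu hwv
  -- The selection runs over intersections of `n + 1` mutually far members of `𝒰`. Each selected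
  -- intersection still leaves `n + 1` candidates containing it, so picking any one of them keeps an
  -- `ω`-cover and leaves room for independence.
  let O : ℕ → Set (Set X) := fun n =>
    {V | ∃ s : Finset (Set X), (∀ U ∈ s, U ∈ 𝒰) ∧ s.card = n + 1 ∧ far s ∧ V = ⋂ U ∈ s, U}
  have hO : ∀ n, O n ∈ omegaCovers X := by
    intro n
    refine mem_omegaCovers ?_ ?_ ?_
    · rintro _ ⟨s, hs, -, -, rfl⟩
      exact isOpen_biInter_finset fun U hU => isOpen_of_mem_omegaCovers h𝒰 (hs U hU)
    · rintro ⟨s, hs, hcard, -, he⟩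
      obtain ⟨U, hU⟩ := Finset.card_pos.1 (show 0 < s.card by omega)
      exact ne_univ_of_mem_omegaCovers h𝒰 (hs U hU)
        (univ_subset_iff.1 (he.subset.trans (biInter_subset_of_mem hU)))
    · intro F hF
      obtain ⟨s, hs, hcard, hfar⟩ := hbig F hF (n + 1)
      exact ⟨_, ⟨s, fun U hU => (hs U hU).1, hcard, hfar, rfl⟩,
        subset_iInter₂ fun U hU => (hs U hU).2⟩
  obtain ⟨T, hT, hTΩ⟩ := h O hO
  choose s hs hcard hfar hTs using hT
  obtain ⟨c, hc, hindep⟩ := exists_independent_choice r s hcard hfar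
  have hsub : range c ⊆ 𝒰 := by
    rintro _ ⟨n, rfl⟩
    exact hs n _ (hc n)
  refine ⟨range c, hsub, mem_omegaCovers_of_refine hTΩ (fun U hU => ⟨𝒰, h𝒰, hsub hU⟩) ?_, ?_⟩
  · rintro _ ⟨n, rfl⟩
    exact ⟨c n, mem_range_self n, (hTs n).subset.trans (biInter_subset_of_mem (hc n))⟩
  · rintro _ ⟨m, rfl⟩ _ ⟨n, rfl⟩ hne hr
    rcases lt_trichotomy m n with hlt | rfl | hlt
    · exact hindep m n hlt hr
    · exact hne rfl
    · exact hindep n m hlt (hsymm _ _ hr)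

/-- The index sets of the `ω`-covers contained in `range a`. -/
def indexFamily (ℬ : Set (Set (Set X))) (a : ℕ → Set X) : Set (Set ℕ) := {I | a '' I ∈ ℬ}

/-- For the diagonalization, `S₁` selects `b n ∈ D (n + 1)`. The order in which the `b n` are
selected need not be their order in `ℕ`, so some pairs violate the requirement. The violating pairs
form a locally finite relation, and an independent `ω`-subcover removes them. -/
theorem isSelectiveCoideal_indexFamily (h : S1 (omegaCovers X) (omegaCovers X)) {a : ℕ → Set X}
    (ha : Function.Injective a) (hA : range a ∈ omegaCovers X) :
    IsSelectiveCoideal (indexFamily (omegaCovers X) a) where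
  mono I hI J hIJ := omegaCovers_superset hI (image_mono hIJ) hA (image_subset_range a J)
  union I J hIJ := by
    have hIJ' : a '' (I ∪ J) ∈ omegaCovers X := hIJ
    rw [image_union] at hIJ'
    exact omegaCovers_union hIJ'
  infinite I hI := (infinite_of_mem_omegaCovers hI).of_image a
  diag D hD hDH := by
    obtain ⟨T, hT, hTΩ⟩ := h (fun n => a '' D (n + 1)) (fun n => hDH (n + 1))
    choose b hb hab using hT
    have hb0 : ∀ n, b n ∈ D 0 := fun n => hD (Nat.zero_le _) (hb n)
    let conflict : ℕ → ℕ → Prop := fun u v => u < v ∧ u ∈ range b ∧ v ∈ range b ∧ v ∉ D (u + 1)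
    have hcl : ∀ v, {u | conflict u v}.Finite := fun v =>
      (finite_Iio v).subset fun u hu => hu.1
    -- If `v = b n` with `n ≥ u`, then `v ∈ D (n + 1) ⊆ D (u + 1)`. Hence only the finitely many `b
    -- n` with `n < u` can conflict with `u` from above.
    have hcr : ∀ u, {v | conflict u v}.Finite := fun u => by
      refine ((finite_Iio u).image b).subset ?_
      rintro _ ⟨-, -, ⟨n, rfl⟩, hv⟩
      refine ⟨n, ?_, rfl⟩
      by_contra hn
      exact hv (hD (Nat.succ_le_succ (not_lt.1 hn)) (hb n))
    let r : Set X → Set X → Prop := fun U V =>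
      ∃ u v, a u = U ∧ a v = V ∧ (conflict u v ∨ conflict v u)
    obtain ⟨𝒱, h𝒱T, h𝒱, hind⟩ := h.exists_independent hTΩ r
      (fun U V ⟨u, v, hu, hv, h⟩ => ⟨v, u, hv, hu, h.symm⟩)
      (fun U => by
        by_cases hU : ∃ u, a u = U
        · obtain ⟨u, rfl⟩ := hU
          refine (((hcr u).union (hcl u)).image a).subset ?_
          rintro _ ⟨u', v, hu, rfl, h⟩
          rw [ha hu] at h
          exact ⟨v, h, rfl⟩
        · refine finite_empty.subset ?_
          rintro _ ⟨u, v, hu, -⟩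
          exact hU ⟨u, hu⟩)
    have h𝒱a : a '' (a ⁻¹' 𝒱) = 𝒱 := by
      refine image_preimage_eq_of_subset (h𝒱T.trans ?_)
      rintro _ ⟨n, rfl⟩
      exact ⟨b n, hab n⟩
    have hmem : ∀ u, a u ∈ 𝒱 → u ∈ range b := by
      intro u hu
      obtain ⟨n, hn⟩ := h𝒱T hu
      exact ⟨n, ha ((hab n).trans hn)⟩
    refine ⟨a ⁻¹' 𝒱, ?_, ?_, ?_⟩
    · change a '' (a ⁻¹' 𝒱) ∈ omegaCovers X
      rwa [h𝒱a]
    · intro u hu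
      obtain ⟨n, rfl⟩ := hmem u hu
      exact hb0 n
    · rintro u hu v ⟨hv, huv⟩
      by_contra hvD
      exact hind _ hu _ hv (fun e => (ne_of_lt huv) (ha e))
        ⟨u, v, rfl, rfl, Or.inl ⟨huv, hmem u hu, hmem v hv, hvD⟩⟩

end Omega

/-! ### The Ellentuck and Cantor topologies on families of countable sets -/

section Topology

variable {α : Type*}

/-- Finite subsets of the range of an enumeration are bounded. -/
theorem exists_bound_of_finite {a : ℕ → α} (ha : Function.Injective a) {s : Set α}
    (hs : s.Finite) : ∃ m, ∀ n, a n ∈ s → n < m := by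
  obtain ⟨m, hm⟩ := (hs.preimage ha.injOn : (a ⁻¹' s).Finite).bddAbove
  exact ⟨m + 1, fun n hn => Nat.lt_succ_of_le (hm hn)⟩

theorem finite_image_of_lt (a : ℕ → α) (D : Set α) (m : ℕ) :
    (a '' {n | n < m ∧ a n ∈ D}).Finite :=
  ((finite_Iio m).subset fun _ hn => hn.1).image a

theorem exists_enumeration {A : Set α} (hc : A.Countable) (hi : A.Infinite) :
    ∃ a : ℕ → α, Function.Injective a ∧ range a = A := by
  have := hi.to_subtype
  have := hc.to_subtype
  obtain ⟨e⟩ := nonempty_equiv_of_countable (α := ℕ) (β := A)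
  exact ⟨Subtype.val ∘ e, Subtype.val_injective.comp e.injective, by
    rw [e.surjective.range_comp, Subtype.range_val]⟩

theorem infSubsets_mono {S T : Set α} (h : S ⊆ T) : infSubsets S ⊆ infSubsets T :=
  fun _ hB => ⟨hB.1.trans h, hB.2⟩

theorem infSubsets_diff {S D s : Set α} (hD : D ∈ infSubsets S) (hs : s.Finite) :
    D \ s ∈ infSubsets S :=
  ⟨sdiff_subset.trans hD.1, hD.2.1.mono sdiff_subset, hD.2.2.sdiff hs⟩

/-- A set is open in the Ellentuck topology iff with each point `D` it contains all subsets of `D`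
that agree with `D` on some initial part of the enumeration. -/
theorem isOpen_ellentuckSubspace_iff {a : ℕ → α} (ha : Function.Injective a) (ℬ : Set (Set α))
    (V : Set (infSubsets (range a) ∩ ℬ : Set (Set α))) :
    @IsOpen _ (ellentuckSubspace a ℬ) V ↔ ∀ D ∈ V, ∃ m, ∀ D' : (infSubsets (range a) ∩ ℬ :
      Set (Set α)), D'.1 ⊆ D.1 → (∀ n < m, a n ∈ D.1 → a n ∈ D'.1) → D' ∈ V := by
  constructor
  · rintro ⟨W, hW, rfl⟩ ⟨D, hD⟩ hDW
    have key : ∀ E ∈ W, ∃ m, ∀ E' : infSubsets (range a), E'.1 ⊆ E.1 →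
        (∀ n < m, a n ∈ E.1 → a n ∈ E'.1) → E' ∈ W := by
      clear hDW
      induction hW with
      | basic W hW =>
        obtain ⟨s, hs, B, hB, hsB, rfl⟩ := hW
        rintro E ⟨-, C, hsC, hCB, hE⟩
        obtain ⟨m, hm⟩ := exists_bound_of_finite ha hs.2
        refine ⟨m, fun E' hE' hag => ⟨E'.2, E'.1 \ s, fun i j hi hj => ?_, ?_, ?_⟩⟩
        · refine hsC i j hi ?_
          have := hE' hj.1
          rw [hE] at this
          exact this.resolve_left hj.2
        · rintro x ⟨hx, hxs⟩
          have := hE' hx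
          rw [hE] at this
          exact hCB (this.resolve_left hxs)
        · rw [union_sdiff_self, eq_comm, union_eq_right]
          intro x hx
          obtain ⟨n, rfl⟩ := hs.1 hx
          exact hag n (hm n hx) (hE ▸ Or.inl hx)
      | univ => exact fun E _ => ⟨0, fun _ _ _ => trivial⟩
      | inter W W' _ _ ih ih' =>
        rintro E ⟨hE, hE'⟩
        obtain ⟨m, hm⟩ := ih E hE
        obtain ⟨m', hm'⟩ := ih' E hE'
        exact ⟨max m m', fun E' hs hag =>
          ⟨hm E' hs fun n hn => hag n (hn.trans_le (le_max_left _ _)),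
            hm' E' hs fun n hn => hag n (hn.trans_le (le_max_right _ _))⟩⟩
      | sUnion 𝒲 _ ih =>
        rintro E ⟨W, hW, hE⟩
        obtain ⟨m, hm⟩ := ih W hW E hE
        exact ⟨m, fun E' hs hag => ⟨W, hW, hm E' hs hag⟩⟩
    obtain ⟨m, hm⟩ := key _ hDW
    exact ⟨m, fun D' hs hag => hm _ hs hag⟩
  · intro h
    let _ := ellentuckSubspace a ℬ
    rw [isOpen_iff_forall_mem_open]
    intro D hD
    obtain ⟨m, hm⟩ := h D hD
    -- The neighbourhood of `D` is `[s, D \ s]`, where `s` is the part of `D` with indices below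
    -- `m`.
    let s := a '' {n | n < m ∧ a n ∈ D.1}
    have hsfin : s.Finite := finite_image_of_lt a D.1 m
    have hsD : s ⊆ D.1 := by
      rintro _ ⟨n, hn, rfl⟩
      exact hn.2
    have hsB : Precedes a s (D.1 \ s) := by
      rintro i j ⟨i', hi, hii⟩ ⟨hj, hjs⟩
      rw [ha hii] at hi
      by_contra hlt
      exact hjs ⟨j, ⟨(not_lt.1 hlt).trans_lt hi.1, hj⟩, rfl⟩
    refine ⟨inclusion inter_subset_left ⁻¹' (Subtype.val ⁻¹' ellentuckBasic a s (D.1 \ s)),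
      ?_, ⟨_, TopologicalSpace.isOpen_generateFrom_of_mem ⟨s, ⟨image_subset_range _ _, hsfin⟩,
        D.1 \ s, infSubsets_diff D.2.1 hsfin, hsB, rfl⟩, rfl⟩,
      ⟨D.2.1, D.1 \ s, hsB, Subset.rfl, ?_⟩⟩
    · rintro D' ⟨-, C, hsC, hC, hD'⟩
      have hD' : D'.1 = s ∪ C := hD'
      refine hm D' ?_ fun n hn hnD => ?_
      · rw [hD']
        exact union_subset hsD (hC.trans sdiff_subset)
      · rw [hD']
        exact Or.inl ⟨n, ⟨hn, hnD⟩, rfl⟩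
    · exact (union_sdiff_cancel hsD).symm

/-- A set of subsets of `A` that contains with each point `D` all sets that agree with `D` on some
finite subset of `A` is open in the topology inherited from `2^A`. -/
theorem isOpen_cantorSubspace_of_forall {A : Set α} {ℬ : Set (Set α)}
    {V : Set (infSubsets A ∩ ℬ : Set (Set α))}
    (h : ∀ D ∈ V, ∃ F : Set α, F.Finite ∧ F ⊆ A ∧ ∀ D' : (infSubsets A ∩ ℬ : Set (Set α)),
      (∀ x ∈ F, x ∈ D'.1 ↔ x ∈ D.1) → D' ∈ V) :
    @IsOpen _ (cantorSubspace A ℬ) V := by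
  let _ := cantorSubspace A ℬ
  rw [isOpen_iff_forall_mem_open]
  intro D hD
  obtain ⟨F, hF, hFA, hFV⟩ := h D hD
  refine ⟨(fun D => charFun A (D : Set α)) ⁻¹'
    (pi (Subtype.val ⁻¹' F) fun x => {charFun A D.1 x}), fun D' hD' => hFV D' fun x hx => ?_,
    ⟨_, isOpen_set_pi (hF.preimage Subtype.val_injective.injOn) fun _ _ => isOpen_discrete _, rfl⟩,
    fun x _ => rfl⟩
  have := hD' ⟨x, hFA hx⟩ hx
  simpa [charFun] using this

/-- Sets open in the topology inherited from `2^A` are open in the Ellentuck topology. -/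
theorem isOpen_ellentuckSubspace_of_cantorSubspace {a : ℕ → α} (ha : Function.Injective a)
    {ℬ : Set (Set α)} {V : Set (infSubsets (range a) ∩ ℬ : Set (Set α))}
    (hV : @IsOpen _ (cantorSubspace (range a) ℬ) V) : @IsOpen _ (ellentuckSubspace a ℬ) V := by
  obtain ⟨W, hW, rfl⟩ := hV
  rw [isOpen_ellentuckSubspace_iff ha]
  intro D hD
  obtain ⟨F, u, hu, hFW⟩ := isOpen_pi_iff.1 hW _ hD
  obtain ⟨m, hm⟩ := exists_bound_of_finite ha (F.finite_toSet.image Subtype.val)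
  refine ⟨m, fun D' hD' hag => hFW fun x hx => ?_⟩
  have hxD : charFun (range a) D'.1 x = charFun (range a) D.1 x := by
    obtain ⟨_, n, rfl⟩ := x
    have hn : n < m := hm n ⟨_, hx, rfl⟩
    simp only [charFun, decide_eq_decide]
    exact ⟨fun h => hD' h, hag n hn⟩
  change charFun (range a) D'.1 x ∈ u x
  rw [hxD]
  exact (hu x hx).2

/-- Having an initial segment in a fixed family of finite sets is an open property. -/
theorem isOpen_cantorSubspace_initialSegment {a : ℕ → α} (ha : Function.Injective a)
    (ℬ 𝒮 : Set (Set α)) (h𝒮 : 𝒮 ⊆ finSubsets (range a)) :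
    @IsOpen _ (cantorSubspace (range a) ℬ) (Subtype.val ⁻¹'
      {C ∈ infSubsets (range a) ∩ ℬ | ∃ s ∈ 𝒮, IsInitialSegment a s C}) := by
  refine isOpen_cantorSubspace_of_forall ?_
  rintro ⟨D, hD⟩ ⟨-, s, hs, hsD, hpre⟩
  obtain ⟨m, hm⟩ := exists_bound_of_finite ha (h𝒮 hs).2
  refine ⟨a '' Iio m, (finite_Iio m).image a, image_subset_range _ _, fun D' hag =>
    ⟨D'.2, s, hs, fun x hx => ?_, fun i j hi hj => ?_⟩⟩
  · obtain ⟨n, rfl⟩ := (h𝒮 hs).1 hx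
    exact (hag _ (mem_image_of_mem a (hm n hx))).2 (hsD hx)
  · by_contra hlt
    have hj' := (hag _ (mem_image_of_mem a ((not_lt.1 hlt).trans_lt (hm i hi)))).1 hj.1
    exact hlt (hpre i j hi ⟨hj', hj.2⟩)

/-- The statement `E` implies the statement `GP`. -/
theorem EllentuckStatement.galvinPrikry {𝒜 ℬ : Set (Set α)} (h : EllentuckStatement 𝒜 ℬ) :
    GalvinPrikryStatement 𝒜 ℬ := by
  intro A hA hAc hAi R hR hRo S hS
  obtain ⟨a, ha, rfl⟩ := exists_enumeration hAc hAi
  obtain ⟨B, hBS, hBi, hB, hdec⟩ := h _ hA a ha rfl R hR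
    ⟨_, ∅, isOpen_ellentuckSubspace_of_cantorSubspace ha hRo, by
      let _ := ellentuckSubspace a ℬ
      exact IsMeagre.empty, by simp⟩
    S hS.1.1 hS.2 ∅ ⟨empty_subset _, finite_empty⟩
  have hBS : B ⊆ S := fun x hx => (hBS hx).1
  have hsub : infSubsets B ⊆ ellentuckBasic a ∅ B := fun D hD =>
    ⟨infSubsets_mono (hBS.trans hS.1.1) hD, D, fun _ _ h => h.elim, hD.1, by simp⟩
  refine ⟨B, ⟨⟨hBS, hS.1.2.1.mono hBS, hBi⟩, hB⟩, hdec.imp ?_ ?_⟩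
  · exact (inter_subset_inter_left _ hsub).trans
  · exact fun h => subset_empty_iff.1
      ((inter_subset_inter_left _ (inter_subset_inter_left _ hsub)).trans h.subset)

end Topology

/-! ### Ellentuck's theorem for ω-covers -/

section Ellentuck

variable {X : Type*} [TopologicalSpace X]

theorem image_mem_infSubsets {a : ℕ → Set X} {I : Set ℕ}
    (hI : I ∈ indexFamily (omegaCovers X) a) :
    a '' I ∈ infSubsets (range a) ∩ omegaCovers X :=
  ⟨⟨image_subset_range _ _, (to_countable I).image a, infinite_of_mem_omegaCovers hI⟩, hI⟩

/-- The index sets of the members of a set of countable `ω`-covers. -/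
def indexSets (a : ℕ → Set X) (V : Set (infSubsets (range a) ∩ omegaCovers X : Set (Set (Set X)))) :
    Set (Set ℕ) :=
  {I | ∃ h, (⟨a '' I, h⟩ : (infSubsets (range a) ∩ omegaCovers X : Set (Set (Set X)))) ∈ V}

theorem indexSets_isOpen {a : ℕ → Set X} (ha : Function.Injective a)
    {V : Set (infSubsets (range a) ∩ omegaCovers X : Set (Set (Set X)))}
    (hV : @IsOpen _ (ellentuckSubspace a (omegaCovers X)) V) :
    ∀ D ∈ indexSets a V, ∃ m, ∀ D' ∈ indexFamily (omegaCovers X) a, D' ⊆ D →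
      (∀ n < m, n ∈ D → n ∈ D') → D' ∈ indexSets a V := by
  rintro D ⟨h, hDV⟩
  obtain ⟨m, hm⟩ := (isOpen_ellentuckSubspace_iff ha _ V).1 hV _ hDV
  refine ⟨m, fun D' hD' hs hag => ⟨image_mem_infSubsets hD', hm _ (image_mono hs) ?_⟩⟩
  intro n hn hnD
  exact mem_image_of_mem a (hag n hn ((ha.mem_set_image).1 hnD))

/-- Basic sets meet dense sets. -/
theorem natBasic_inter_nonempty {a : ℕ → Set X} (ha : Function.Injective a)
    (hA : range a ∈ omegaCovers X)
    {V : Set (infSubsets (range a) ∩ omegaCovers X : Set (Set (Set X)))}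
    (hV : @Dense _ (ellentuckSubspace a (omegaCovers X)) V) (s : Finset ℕ) {B : Set ℕ}
    (hB : B ∈ indexFamily (omegaCovers X) a) (hsB : B ⊆ above s) :
    (natBasic (indexFamily (omegaCovers X) a) s B ∩ indexSets a V).Nonempty := by
  let _ := ellentuckSubspace a (omegaCovers X)
  let W : Set (infSubsets (range a) ∩ omegaCovers X : Set (Set (Set X))) :=
    {y | a ⁻¹' y.1 ∈ natBasic (indexFamily (omegaCovers X) a) s B}
  have himg : ∀ y : (infSubsets (range a) ∩ omegaCovers X : Set (Set (Set X))),
      a '' (a ⁻¹' y.1) = y.1 := fun y => image_preimage_eq_of_subset y.2.1.1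
  have hW : IsOpen W := by
    rw [isOpen_ellentuckSubspace_iff ha]
    rintro y ⟨hy, hsy, hyB⟩
    refine ⟨s.sup id + 1, fun y' hy' hag => ⟨?_, fun i hi => ?_, fun j hj hjs => ?_⟩⟩
    · change a '' _ ∈ omegaCovers X
      rw [himg]
      exact y'.2.2
    · exact hag i (Nat.lt_succ_of_le (Finset.le_sup (f := id) hi)) (hsy hi)
    · exact hyB j (hy' hj) hjs
  have hsB' : (s : Set ℕ) ∪ B ∈ indexFamily (omegaCovers X) a :=
    omegaCovers_superset hB (image_mono subset_union_right) hA (image_subset_range _ _)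
  obtain ⟨y, hyW, hyV⟩ := hV.inter_open_nonempty W hW ⟨⟨_, image_mem_infSubsets hsB'⟩, by
    change a ⁻¹' (a '' _) ∈ natBasic (indexFamily (omegaCovers X) a) s B
    rw [preimage_image_eq _ ha]
    exact ⟨hsB', subset_union_left, fun j hj hjs =>
      ⟨hj.resolve_left hjs, hsB (hj.resolve_left hjs)⟩⟩⟩
  refine ⟨a ⁻¹' y.1, hyW, ?_⟩
  refine ⟨by rw [himg]; exact y.2, ?_⟩
  convert hyV using 1
  exact Subtype.ext (himg y)

/-- `S₁(Ω, Ω)` implies the Ellentuck theorem for `ω`-covers. -/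
theorem S1.ellentuck (h : S1 (omegaCovers X) (omegaCovers X)) :
    EllentuckStatement (omegaCovers X) (omegaCovers X) := by
  rintro _ hA a ha rfl R hR ⟨U, M, hU, hM, hRUM⟩ S hSA hS s hs
  have hH := isSelectiveCoideal_indexFamily h ha hA
  obtain ⟨𝒟, h𝒟o, h𝒟d, h𝒟c, h𝒟M⟩ := by
    let _ := ellentuckSubspace a (omegaCovers X)
    exact mem_residual_iff.1 hM
  have h𝒟 : ∃ D : ℕ → Set (infSubsets (range a) ∩ omegaCovers X : Set (Set (Set X))),
      (∀ n, @IsOpen _ (ellentuckSubspace a (omegaCovers X)) (D n)) ∧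
      (∀ n, @Dense _ (ellentuckSubspace a (omegaCovers X)) (D n)) ∧ ⋂ n, D n ⊆ Mᶜ := by
    let _ := ellentuckSubspace a (omegaCovers X)
    rcases 𝒟.eq_empty_or_nonempty with rfl | hne
    · exact ⟨fun _ => univ, fun _ => isOpen_univ, fun _ => dense_univ, by simpa using h𝒟M⟩
    · obtain ⟨D, rfl⟩ := h𝒟c.exists_eq_range hne
      exact ⟨D, fun n => h𝒟o _ (mem_range_self n), fun n => h𝒟d _ (mem_range_self n),
        by rwa [sInter_range] at h𝒟M⟩
  obtain ⟨D, hDo, hDd, hDM⟩ := h𝒟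
  have hfin : (a ⁻¹' s).Finite := hs.2.preimage ha.injOn
  let t : Finset ℕ := hfin.toFinset
  have ht : ∀ i, i ∈ t ↔ a i ∈ s := fun i => by simp [t]
  have hSH : a ⁻¹' S ∈ indexFamily (omegaCovers X) a := by
    change a '' _ ∈ omegaCovers X
    rwa [image_preimage_eq_of_subset hSA]
  -- `B₁` decides the open part `U`. The set `B` then shrinks it so that `[t, B]` misses `M`:
  -- complements of dense open sets are null, because a basic set cannot be disjoint from a dense
  -- set. On `[t, B]`, `R` coincides with `U`.
  obtain ⟨B₁, hB₁, hB₁S, hB₁U⟩ := hH.ramsey_of_open (indexSets_isOpen ha hU) t hSH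
  obtain ⟨B, hB, hBB₁, hBM⟩ := hH.null_iUnion
    (N := fun n => indexFamily (omegaCovers X) a \ indexSets a (D n)) (fun k u T hT => by
      obtain ⟨B, hB, hBT, hdec⟩ := hH.ramsey_of_open (indexSets_isOpen ha (hDo k)) u hT
      refine ⟨B, hB, hBT.trans inter_subset_left, ?_⟩
      rcases hdec with hdec | hdec
      · exact eq_empty_iff_forall_notMem.2 fun E hE => hE.2.2 (hdec hE.1)
      · exact absurd (natBasic_inter_nonempty ha hA (hDd k) u hB (hBT.trans inter_subset_right))
          (not_nonempty_iff_eq_empty.2 hdec)) t hB₁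
  have htrans : ∀ E ∈ ellentuckBasic a s (a '' B) ∩ omegaCovers X,
      a ⁻¹' E ∈ natBasic (indexFamily (omegaCovers X) a) t B ∧ a '' (a ⁻¹' E) = E := by
    rintro E ⟨⟨hE, C, hsC, hCB, hEC⟩, hEΩ⟩
    have himg : a '' (a ⁻¹' E) = E := image_preimage_eq_of_subset hE.1
    refine ⟨⟨?_, fun i hi => ?_, fun j hj hjs => ?_⟩, himg⟩
    · change a '' _ ∈ omegaCovers X
      rwa [himg]
    · exact hEC ▸ Or.inl ((ht i).1 hi)
    · have hj : a j ∈ E := hj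
      rw [hEC] at hj
      have hjC := hj.resolve_left fun h => hjs ((ht j).2 h)
      exact ⟨(ha.mem_set_image).1 (hCB hjC), fun i hi => hsC i j ((ht i).1 hi) hjC⟩
  have hmem : ∀ E ∈ ellentuckBasic a s (a '' B) ∩ omegaCovers X,
      ∀ hE : E ∈ infSubsets (range a) ∩ omegaCovers X,
      E ∈ R ↔ (⟨E, hE⟩ : (infSubsets (range a) ∩ omegaCovers X : Set (Set (Set X)))) ∈ U := by
    intro E hEB hE
    obtain ⟨hnat, himg⟩ := htrans E hEB
    have hnotM : (⟨E, hE⟩ : (infSubsets (range a) ∩ omegaCovers X : Set (Set (Set X)))) ∉ M := by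
      refine hDM (mem_iInter.2 fun n => ?_)
      by_contra hn
      refine eq_empty_iff_forall_notMem.1 hBM _ ⟨hnat, mem_iUnion.2 ⟨n, hnat.1, ?_⟩⟩
      rintro ⟨h', hmem⟩
      apply hn
      convert hmem using 1
      exact Subtype.ext himg.symm
    have hRiff := Set.ext_iff.1 hRUM ⟨E, hE⟩
    constructor
    · intro h
      rcases hRiff.1 h with h | h
      · exact h.1
      · exact absurd h.1 hnotM
    · exact fun h => hRiff.2 (Or.inl ⟨h, hnotM⟩)
  refine ⟨a '' B, ?_, infinite_of_mem_omegaCovers hB, hB, ?_⟩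
  · rintro _ ⟨i, hi, rfl⟩
    have hi' := hB₁S (hBB₁ hi)
    refine ⟨hi'.1, fun j k hj hk => ?_⟩
    rw [ha hk]
    exact hi'.2 j ((ht j).2 hj)
  · rcases hB₁U with hU' | hU'
    · refine Or.inl fun E hE => ?_
      obtain ⟨hnat, himg⟩ := htrans E hE
      obtain ⟨h', hmem'⟩ := hU' (natBasic_mono hBB₁ hnat)
      refine (hmem E hE ⟨hE.1.1, hE.2⟩).2 ?_
      convert hmem' using 1
      exact Subtype.ext himg.symm
    · refine Or.inr (eq_empty_iff_forall_notMem.2 ?_)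
      rintro E ⟨hE, hER⟩
      obtain ⟨hnat, himg⟩ := htrans E hE
      refine eq_empty_iff_forall_notMem.1 hU' _ ⟨natBasic_mono hBB₁ hnat,
        by rw [himg]; exact ⟨hE.1.1, hE.2⟩, ?_⟩
      convert (hmem E hE ⟨hE.1.1, hE.2⟩).1 hER using 1
      exact Subtype.ext himg

end Ellentuck

theorem eq_zero_of_ne_one : ∀ {i : Fin 2}, i ≠ 1 → i = 0 := by decide

/-! ### Comparability of initial segments -/

section InitialSegments

variable {α : Type*}

theorem IsInitialSegment.subset_or_subset {a : ℕ → α} {s t C : Set α} (hC : C ⊆ range a)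
    (hs : IsInitialSegment a s C) (ht : IsInitialSegment a t C) : s ⊆ t ∨ t ⊆ s := by
  by_contra! h
  obtain ⟨x, hxs, hxt⟩ := not_subset.1 h.1
  obtain ⟨y, hyt, hys⟩ := not_subset.1 h.2
  obtain ⟨i, rfl⟩ := hC (hs.1 hxs)
  obtain ⟨j, rfl⟩ := hC (ht.1 hyt)
  exact lt_asymm (hs.2 i j hxs ⟨ht.1 hyt, hys⟩) (ht.2 j i hyt ⟨hs.1 hxs, hxt⟩)

theorem IsInitialSegment.of_subset {a : ℕ → α} {s t C : Set α}
    (hs : IsInitialSegment a s C) (ht : t ⊆ C) (hst : s ⊆ t) : IsInitialSegment a s t :=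
  ⟨hst, fun i j hi hj => hs.2 i j hi ⟨ht hj.1, hj.2⟩⟩

end InitialSegments

/-! ### From Galvin–Prikry to Galvin, Nash-Williams and Ramsey relations -/

section Omega

variable {X : Type*} [TopologicalSpace X]

theorem mem_infSubsets_of_subset {A S B : Set (Set X)} (hA : A ∈ infSubsets S) (hBA : B ⊆ A)
    (hB : B ∈ omegaCovers X) : B ∈ infSubsets A :=
  ⟨hBA, hA.2.1.mono hBA, infinite_of_mem_omegaCovers hB⟩

/-- Every finite subset of a countable `ω`-cover `B` is an initial segment of some `ω`-cover
contained in `B`. -/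
theorem exists_isInitialSegment {a : ℕ → Set X} (ha : Function.Injective a)
    {B s : Set (Set X)} (hB : B ∈ infSubsets (range a) ∩ omegaCovers X) (hs : s ∈ finSubsets B) :
    ∃ C ∈ infSubsets B ∩ omegaCovers X, IsInitialSegment a s C := by
  obtain ⟨m, hm⟩ := exists_bound_of_finite ha hs.2
  -- Outside `s`, only members of `B` with index at least `m` are kept. Finitely many are lost, so
  -- an `ω`-cover remains.
  have hCB : s ∪ B \ a '' Iio m ⊆ B := union_subset hs.1 sdiff_subset
  have hC : s ∪ B \ a '' Iio m ∈ omegaCovers X :=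
    omegaCovers_superset (omegaCovers_diff_finite hB.2 ((finite_Iio m).image a))
      subset_union_right hB.2 hCB
  refine ⟨_, ⟨mem_infSubsets_of_subset hB.1 hCB hC, hC⟩, subset_union_left, fun i j hi hj => ?_⟩
  by_contra hlt
  exact (hj.1.resolve_left hj.2).2 ⟨j, (not_lt.1 hlt).trans_lt (hm i hi), rfl⟩

/-- The Galvin–Prikry statement implies Galvin's statement below each countable `ω`-cover. -/
theorem GalvinPrikryStatement.exists_initialSegment
    (h : GalvinPrikryStatement (omegaCovers X) (omegaCovers X)) {a : ℕ → Set X}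
    (ha : Function.Injective a) (hA : range a ∈ omegaCovers X) {S : Set (Set X)}
    (hS : S ∈ infSubsets (range a) ∩ omegaCovers X) {𝒮 : Set (Set (Set X))}
    (h𝒮 : 𝒮 ⊆ finSubsets (range a)) (hd : IsDenseFamily (omegaCovers X) S 𝒮) :
    ∃ B ∈ infSubsets S ∩ omegaCovers X, ∀ C ∈ infSubsets B ∩ omegaCovers X,
      ∃ s ∈ 𝒮, IsInitialSegment a s C := by
  obtain ⟨B, hB, hBR⟩ := h _ hA (countable_range a) (infinite_range_of_injective ha)
    {C ∈ infSubsets (range a) ∩ omegaCovers X | ∃ s ∈ 𝒮, IsInitialSegment a s C}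
    (sep_subset _ _) (isOpen_cantorSubspace_initialSegment ha _ 𝒮 h𝒮) S hS
  refine ⟨B, hB, fun C hC => ?_⟩
  rcases hBR with hBR | hBR
  · exact (hBR hC).2
  -- The negative alternative fails: density puts some `s ∈ 𝒮` inside `B`, and `s` is an initial
  -- segment of some `ω`-cover contained in `B`.
  · obtain ⟨s, hs, hsB⟩ := hd B hB
    have hB' := infSubsets_mono hS.1.1 hB.1
    obtain ⟨D, hD, hsD⟩ := exists_isInitialSegment ha ⟨hB', hB.2⟩ hsB
    exact absurd ⟨hD, ⟨infSubsets_mono hB'.1 hD.1, hD.2⟩, s, hs, hsD⟩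
      (eq_empty_iff_forall_notMem.1 hBR D)

theorem GalvinPrikryStatement.galvin
    (h : GalvinPrikryStatement (omegaCovers X) (omegaCovers X)) :
    GalvinStatement (omegaCovers X) (omegaCovers X) := by
  rintro _ hA a ha rfl 𝒮 h𝒮 hd
  exact h.exists_initialSegment ha hA
    ⟨⟨Subset.rfl, countable_range a, infinite_range_of_injective ha⟩, hA⟩ h𝒮 hd

/-- Choose `B` meeting the fewest parts. By minimality every part that it meets is dense below `B`.
For such a part, some `C` has the property that each `ω`-cover inside it starts with an element of
that part. Any `t ∈ 𝒯` inside `C` also starts such a cover, and thinness makes the two segments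
equal. -/
theorem GalvinPrikryStatement.nashWilliams
    (h : GalvinPrikryStatement (omegaCovers X) (omegaCovers X)) :
    NashWilliamsStatement (omegaCovers X) (omegaCovers X) := by
  classical
  rintro _ hA a ha rfl 𝒯 h𝒯 hthin n hn P hP h𝒯P
  let parts : Set (Set X) → Finset (Fin n) :=
    fun B => Finset.univ.filter fun i => (P i ∩ finSubsets B).Nonempty
  obtain ⟨B, hB, hmin⟩ := (measure fun B => (parts B).card).wf.has_min
    (infSubsets (range a) ∩ omegaCovers X)
    ⟨_, ⟨Subset.rfl, countable_range a, infinite_range_of_injective ha⟩, hA⟩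
  by_cases hne : (parts B).Nonempty
  swap
  -- No element of `𝒯` lies in `B`, so any part will do, and `n ≥ 1` provides index `0`.
  · refine ⟨B, hB, ⟨0, hn⟩, ?_⟩
    rintro s ⟨hsB, hs⟩
    rw [h𝒯P] at hs
    obtain ⟨i, hi⟩ := mem_iUnion.1 hs
    exact absurd ⟨i, Finset.mem_filter.2 ⟨Finset.mem_univ i, s, hi, hsB⟩⟩ hne
  obtain ⟨i, hi⟩ := hne
  have hPi : P i ⊆ 𝒯 := h𝒯P ▸ subset_iUnion P i
  have hdense : IsDenseFamily (omegaCovers X) B (P i) := by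
    intro C hC
    by_contra hempty
    refine hmin C ⟨infSubsets_mono hB.1.1 hC.1, hC.2⟩ (Finset.card_lt_card ?_)
    rw [Finset.ssubset_iff_of_subset]
    · exact ⟨i, hi, fun h => hempty (Finset.mem_filter.1 h).2⟩
    · intro j hj
      obtain ⟨s, hs, hsC⟩ := (Finset.mem_filter.1 hj).2
      exact Finset.mem_filter.2 ⟨Finset.mem_univ j, s, hs, hsC.1.trans hC.1.1, hsC.2⟩
  obtain ⟨C, hC, hCi⟩ := h.exists_initialSegment ha hA hB (hPi.trans h𝒯) hdense
  have hC' := infSubsets_mono hB.1.1 hC.1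
  refine ⟨C, ⟨hC', hC.2⟩, i, ?_⟩
  rintro t ⟨htC, ht⟩
  obtain ⟨D, hD, htD⟩ := exists_isInitialSegment ha ⟨hC', hC.2⟩ htC
  obtain ⟨s, hs, hsD⟩ := hCi D hD
  have hst : s = t := by
    by_contra hne
    rcases hsD.subset_or_subset (hD.1.1.trans hC'.1) htD with hsub | hsub
    · exact hthin s (hPi hs) t ht hne (hsD.of_subset htD.1 hsub)
    · exact hthin t ht s (hPi hs) (Ne.symm hne) (htD.of_subset hsD.1 hsub)
  exact hst ▸ hs

variable (hX : ∀ 𝒰 ∈ omegaCovers X, ∃ 𝒱 ⊆ 𝒰, 𝒱.Countable ∧ 𝒱 ∈ omegaCovers X)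

include hX

theorem exists_enumerated_subcover {𝒰 : Set (Set X)} (h𝒰 : 𝒰 ∈ omegaCovers X) :
    ∃ a : ℕ → Set X, Function.Injective a ∧ range a ⊆ 𝒰 ∧ range a ∈ omegaCovers X := by
  obtain ⟨𝒱, hs, hc, h𝒱⟩ := hX 𝒰 h𝒰
  obtain ⟨a, ha, rfl⟩ := exists_enumeration hc (infinite_of_mem_omegaCovers h𝒱)
  exact ⟨a, ha, hs, h𝒱⟩

theorem NashWilliamsStatement.arrow
    (h : NashWilliamsStatement (omegaCovers X) (omegaCovers X)) (n k : ℕ) (hk : 1 ≤ k) :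
    Arrow (omegaCovers X) (fun _ : Fin k => omegaCovers X) n := by
  intro A hA f
  obtain ⟨a, ha, haA, haΩ⟩ := exists_enumerated_subcover hX hA
  let P : Fin k → Set (Set (Set X)) := fun i =>
    {s | s ⊆ range a ∧ ∃ t : cardSubsets A n, ((t : Finset (Set X)) : Set (Set X)) = s ∧ f t = i}
  obtain ⟨B, hB, i, hBi⟩ := h _ haΩ a ha rfl (⋃ i, P i)
    (by
      refine iUnion_subset fun i => ?_
      rintro _ ⟨hs, t, rfl, -⟩
      exact ⟨hs, t.1.finite_toSet⟩)
    (by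
      intro s hs t ht hne hst
      obtain ⟨-, -, s, rfl, -⟩ := mem_iUnion.1 hs
      obtain ⟨-, -, t, rfl, -⟩ := mem_iUnion.1 ht
      refine hne (congrArg _ (Finset.eq_of_subset_of_card_le (Finset.coe_subset.1 hst.1) ?_))
      rw [s.2.2, t.2.2])
    k hk P
    (by
      intro i j hij
      refine disjoint_left.2 ?_
      rintro _ ⟨-, s, rfl, hs⟩ ⟨-, t, hst, ht⟩
      have : t = s := Subtype.ext (Finset.coe_injective hst)
      exact hij (hs ▸ ht ▸ this ▸ rfl))
    rfl
  refine ⟨i, B, hB.1.1.trans haA, hB.2, fun s hs => ?_⟩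
  obtain ⟨-, t, hst, ht⟩ := hBi ⟨⟨hs, s.1.finite_toSet⟩,
    mem_iUnion.2 ⟨f s, hs.trans hB.1.1, s, rfl, rfl⟩⟩
  rwa [Subtype.ext (Finset.coe_injective hst)] at ht

/-- The Galvin statement is applied to the pairs of colour `1`. If they are dense, every pair in the
resulting `B` starts some cover that also starts with a pair of colour `1`, so the two agree. If
not, some `ω`-cover contains no pair of colour `1`. -/
theorem GalvinStatement.arrow_two (h : GalvinStatement (omegaCovers X) (omegaCovers X)) :
    Arrow (omegaCovers X) ![omegaCovers X, omegaCovers X] 2 := by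
  intro A hA f
  obtain ⟨a, ha, haA, haΩ⟩ := exists_enumerated_subcover hX hA
  let 𝒮 : Set (Set (Set X)) :=
    {s | s ⊆ range a ∧ ∃ t : cardSubsets A 2, ((t : Finset (Set X)) : Set (Set X)) = s ∧ f t = 1}
  by_cases hd : IsDenseFamily (omegaCovers X) (range a) 𝒮
  · obtain ⟨B, hB, hBC⟩ := h _ haΩ a ha rfl 𝒮
      (by rintro _ ⟨hs, t, rfl, -⟩; exact ⟨hs, t.1.finite_toSet⟩) hd
    refine ⟨1, B, hB.1.1.trans haA, hB.2, fun t ht => ?_⟩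
    obtain ⟨C, hC, htC⟩ := exists_isInitialSegment ha hB ⟨ht, t.1.finite_toSet⟩
    obtain ⟨_, ⟨-, s, rfl, hs⟩, hsC⟩ := hBC C hC
    have hst : s = t := by
      refine Subtype.ext ?_
      rcases hsC.subset_or_subset (hC.1.1.trans hB.1.1) htC with hsub | hsub
      · exact Finset.eq_of_subset_of_card_le (Finset.coe_subset.1 hsub) (by rw [s.2.2, t.2.2])
      · exact (Finset.eq_of_subset_of_card_le (Finset.coe_subset.1 hsub)
          (by rw [s.2.2, t.2.2])).symm
    rwa [hst] at hs
  · simp only [IsDenseFamily, not_forall] at hd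
    obtain ⟨B, hB, hempty⟩ := hd
    refine ⟨0, B, hB.1.1.trans haA, hB.2, fun t ht => ?_⟩
    have hne : f t ≠ 1 := fun h1 =>
      hempty ⟨_, ⟨ht.trans hB.1.1, t, rfl, h1⟩, ht, t.1.finite_toSet⟩
    exact eq_zero_of_ne_one hne

end Omega

/-! ### Recovering the selection principle from partition relations -/

section Converse

variable {X : Type*} [TopologicalSpace X]

/-- A choice of members of the `O n` that depends only on an index and refines to an `ω`-cover
extends to a selector. -/
theorem exists_selector {O : ℕ → Set (Set X)} (hO : ∀ n, O n ∈ omegaCovers X) {B : Set (Set X)}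
    (hB : B ∈ omegaCovers X) (idx : Set X → ℕ) (sel : Set X → Set X)
    (hmem : ∀ V ∈ B, sel V ∈ O (idx V)) (hsub : ∀ V ∈ B, V ⊆ sel V)
    (hinj : ∀ V ∈ B, ∀ W ∈ B, idx V = idx W → sel V = sel W) :
    ∃ T : ℕ → Set X, (∀ n, T n ∈ O n) ∧ range T ∈ omegaCovers X := by
  have hex : ∀ n, ∃ U ∈ O n, ∀ V ∈ B, idx V = n → U = sel V := by
    intro n
    by_cases hn : ∃ V ∈ B, idx V = n
    · obtain ⟨V, hV, rfl⟩ := hn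
      exact ⟨sel V, hmem V hV, fun W hW h => hinj V hV W hW h.symm⟩
    · obtain ⟨U, hU, -⟩ := (hO n).2.2 ∅ finite_empty
      exact ⟨U, hU, fun V hV h => absurd ⟨V, hV, h⟩ hn⟩
  choose T hT hTsel using hex
  refine ⟨T, hT, mem_omegaCovers_of_refine hB ?_ fun V hV => ?_⟩
  · rintro _ ⟨n, rfl⟩
    exact ⟨O n, hO n, hT n⟩
  · exact ⟨T (idx V), mem_range_self _, (hTsel _ V hV rfl).symm ▸ hsub V hV⟩

/-- The indices of an `ω`-cover that refines `w` along `idx` are unbounded. -/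
theorem exists_lt_idx {w : ℕ → Set X} (hw : range w ∈ omegaCovers X) {B : Set (Set X)}
    (hB : B ∈ omegaCovers X) (idx : Set X → ℕ) (hsub : ∀ V ∈ B, V ⊆ w (idx V)) (m : ℕ) :
    ∃ V ∈ B, m < idx V := by
  obtain ⟨V, hV, hn⟩ := exists_not_subset_of_finite hB ((finite_Iic m).image w) (by
    rintro ⟨n, -, hn⟩
    exact hw.2.1 ⟨n, hn⟩)
  exact ⟨V, hV, not_le.1 fun hle => hn _ (mem_image_of_mem w hle) (hsub V hV)⟩

/-- The cover by the sets `w n ∩ U`, `U ∈ O n`. -/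
def stratifiedCover (w : ℕ → Set X) (O : ℕ → Set (Set X)) : Set (Set X) :=
  {V | ∃ n, ∃ U ∈ O n, V = w n ∩ U}

theorem stratifiedCover_mem {w : ℕ → Set X} (hw : range w ∈ omegaCovers X) {O : ℕ → Set (Set X)}
    (hO : ∀ n, O n ∈ omegaCovers X) : stratifiedCover w O ∈ omegaCovers X := by
  refine mem_omegaCovers ?_ ?_ fun F hF => ?_
  · rintro _ ⟨n, U, hU, rfl⟩
    exact (isOpen_of_mem_omegaCovers hw (mem_range_self n)).inter
      (isOpen_of_mem_omegaCovers (hO n) hU)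
  · rintro ⟨n, U, hU, he⟩
    exact ne_univ_of_mem_omegaCovers hw (mem_range_self n)
      (univ_subset_iff.1 (he.subset.trans inter_subset_left))
  · obtain ⟨_, ⟨n, rfl⟩, hn⟩ := hw.2.2 F hF
    obtain ⟨U, hU, hFU⟩ := (hO n).2.2 F hF
    exact ⟨_, ⟨n, U, hU, rfl⟩, subset_inter hn hFU⟩

/-- The pair of two distinct members of `A`, as a two-element subset. -/
theorem pair_mem_cardSubsets {α : Type*} [DecidableEq α] {A : Set α} {x y : α} (hx : x ∈ A)
    (hy : y ∈ A) (hxy : x ≠ y) : ({x, y} : Finset α) ∈ cardSubsets A 2 :=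
  ⟨by simp [insert_subset_iff, hx, hy], Finset.card_pair hxy⟩

theorem forall_mem_pair_eq_iff {α β : Type*} [DecidableEq α] (g : α → β) (x y : α) :
    (∀ v ∈ ({x, y} : Finset α), ∀ w ∈ ({x, y} : Finset α), g v = g w) ↔ g x = g y := by
  refine ⟨fun h => h x (by simp) y (by simp), fun h => ?_⟩
  have hx : ∀ v ∈ ({x, y} : Finset α), g v = g x := by simp [h]
  exact fun v hv w hw => (hx v hv).trans (hx w hw).symm

theorem triple_mem_cardSubsets {α : Type*} [DecidableEq α] {A : Set α} {x y z : α} (hx : x ∈ A)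
    (hy : y ∈ A) (hz : z ∈ A) (hxy : x ≠ y) (hxz : x ≠ z) (hyz : y ≠ z) :
    ({x, y, z} : Finset α) ∈ cardSubsets A 3 :=
  ⟨by simp [insert_subset_iff, hx, hy, hz], Finset.card_eq_three.2 ⟨x, y, z, hxy, hxz, hyz, rfl⟩⟩

theorem omegaCovers_arrow_three
    (h : ∀ n k : ℕ, 1 ≤ n → 1 ≤ k → Arrow (omegaCovers X) (fun _ : Fin k => omegaCovers X) n) :
    Arrow (omegaCovers X) ![omegaCovers X, setsOfCard (Set X) 4] 3 := by
  intro A hA f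
  obtain ⟨i, B, hBA, hB, hf⟩ := h 3 2 (by norm_num) (by norm_num) A hA f
  by_cases hi : i = 0
  · exact ⟨0, B, hBA, hB, fun s hs => (hf s hs).trans hi⟩
  · have hi1 : i = 1 := by omega
    obtain ⟨t, htB, ht⟩ := (infinite_of_mem_omegaCovers hB).exists_subset_card_eq 4
    refine ⟨1, t, htB.trans hBA, ⟨t.finite_toSet, by rw [ncard_coe_finset, ht]⟩,
      fun s hs => (hf s (hs.trans htB)).trans hi1⟩

theorem omegaCovers_squareArrow {n k : ℕ}
    (h : Arrow (omegaCovers X) (fun _ : Fin k => omegaCovers X) n) :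
    SquareArrow (omegaCovers X) (omegaCovers X) n k 2 := by
  intro A hA f
  obtain ⟨i, B, hBA, hB, hf⟩ := h A hA f
  refine ⟨B, hBA, hB, ?_⟩
  refine (ncard_le_ncard (t := {i}) ?_ (finite_singleton i)).trans (by simp)
  rintro _ ⟨s, hs, rfl⟩
  exact hf s hs

theorem omegaCovers_arrow_openCovers
    (h : Arrow (omegaCovers X) ![omegaCovers X, omegaCovers X] 2) :
    Arrow (omegaCovers X) ![omegaCovers X, openCovers X] 2 := by
  intro A hA f
  obtain ⟨i, B, hBA, hB, hf⟩ := h A hA f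
  refine ⟨i, B, hBA, ?_, hf⟩
  fin_cases i
  · exact hB
  · exact hB.1

variable (hX : ∀ 𝒰 ∈ omegaCovers X, ∃ 𝒱 ⊆ 𝒰, 𝒱.Countable ∧ 𝒱 ∈ omegaCovers X)

include hX

/-- A pair has colour `1` when its strata agree. A homogeneous set of colour `1` lies inside one `w
n ≠ X`, so it covers nothing. A homogeneous `ω`-cover of colour `0` has at most one member in each
stratum. -/
theorem S1_of_arrow_openCovers (h : Arrow (omegaCovers X) ![omegaCovers X, openCovers X] 2) :
    S1 (omegaCovers X) (omegaCovers X) := by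
  classical
  intro O hO
  obtain ⟨w, -, -, hw⟩ := exists_enumerated_subcover hX (hO 0)
  have hrep : ∀ V ∈ stratifiedCover w O, ∃ n, ∃ U ∈ O n, V = w n ∩ U := fun V hV => hV
  choose! idx sel hsel hV using hrep
  obtain ⟨i, B, hBA, hB, hf⟩ := h _ (stratifiedCover_mem hw hO)
    (fun s => if ∀ V ∈ s.1, ∀ W ∈ s.1, idx V = idx W then 1 else 0)
  have hpair : ∀ V ∈ B, ∀ W ∈ B, V ≠ W → (idx V = idx W ↔ i = 1) := by
    intro V hVB W hWB hne
    have := hf ⟨_, pair_mem_cardSubsets (hBA hVB) (hBA hWB) hne⟩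
      (by simp [insert_subset_iff, hVB, hWB])
    rw [← this]
    simp [eq_comm]
  by_cases hi : i = 1
  · subst hi
    have hB : B ∈ openCovers X := hB
    obtain ⟨x⟩ := nonempty_of_mem_omegaCovers (hO 0)
    obtain ⟨V, hVB, -⟩ : x ∈ ⋃₀ B := hB.2 ▸ mem_univ x
    refine absurd (univ_subset_iff.1 (hB.2.symm.subset.trans (sUnion_subset fun W hWB => ?_)))
      (ne_univ_of_mem_omegaCovers hw (mem_range_self (idx V)))
    have hidx : idx V = idx W := by
      by_cases hVW : V = W
      · rw [hVW]
      · exact (hpair V hVB W hWB hVW).2 rfl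
    rw [hidx]
    exact (hV W (hBA hWB)).subset.trans inter_subset_left
  · obtain rfl : i = 0 := eq_zero_of_ne_one hi
    refine exists_selector hO hB idx sel (fun V hVB => hsel V (hBA hVB))
      (fun V hVB => (hV V (hBA hVB)).subset.trans inter_subset_right) fun V hVB W hWB hVW => ?_
    by_contra hne
    have hVW' : V ≠ W := fun e => hne (e ▸ rfl)
    exact hi ((hpair V hVB W hWB hVW').1 hVW)

/-- A triple has colour `1` when two of its members share a stratum and the third lies in a later
one. Four sets cannot have only such triples: exactly two would lie in the lowest stratum, and one
of these with the other two sets violates the pattern. In an `ω`-cover of colour `0` no stratum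
repeats, because a later stratum always occurs. -/
theorem S1_of_arrow_four (h : Arrow (omegaCovers X) ![omegaCovers X, setsOfCard (Set X) 4] 3) :
    S1 (omegaCovers X) (omegaCovers X) := by
  classical
  intro O hO
  obtain ⟨w, -, -, hw⟩ := exists_enumerated_subcover hX (hO 0)
  have hrep : ∀ V ∈ stratifiedCover w O, ∃ n, ∃ U ∈ O n, V = w n ∩ U := fun V hV => hV
  choose! idx sel hsel hV using hrep
  obtain ⟨i, B, hBA, hB, hf⟩ := h _ (stratifiedCover_mem hw hO)
    (fun s => if ∃ U ∈ s.1, ∃ V ∈ s.1, ∃ W ∈ s.1, U ≠ V ∧ idx U = idx V ∧ idx U < idx W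
      then 1 else 0)
  by_cases hi : i = 1
  · subst hi
    obtain ⟨hBfin, hBcard⟩ : B ∈ setsOfCard (Set X) 4 := hB
    have htriple : ∀ x ∈ B, ∀ y ∈ B, ∀ z ∈ B, x ≠ y → x ≠ z → y ≠ z →
        (idx x = idx y ∧ idx x < idx z) ∨ (idx x = idx z ∧ idx x < idx y) ∨
          (idx y = idx z ∧ idx y < idx x) := by
      intro x hx y hy z hz hxy hxz hyz
      have := hf ⟨_, triple_mem_cardSubsets (hBA hx) (hBA hy) (hBA hz) hxy hxz hyz⟩
        (by simp [insert_subset_iff, hx, hy, hz])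
      have hcol : ∃ U ∈ ({x, y, z} : Finset (Set X)), ∃ V ∈ ({x, y, z} : Finset (Set X)),
          ∃ W ∈ ({x, y, z} : Finset (Set X)), U ≠ V ∧ idx U = idx V ∧ idx U < idx W := by
        by_contra hcol
        simp only [hcol, if_false] at this
        exact absurd this (by decide)
      obtain ⟨U, hU, V, hV, W, hW, hne, h₁, h₂⟩ := hcol
      simp only [Finset.mem_insert, Finset.mem_singleton] at hU hV hW
      rcases hU with rfl | rfl | rfl <;> rcases hV with rfl | rfl | rfl <;>
        rcases hW with rfl | rfl | rfl <;> first | omega | exact absurd rfl hne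
    obtain ⟨p, t, hpt, hBt, hcard⟩ := (ncard_eq_succ hBfin).1 hBcard
    obtain ⟨q, r, u, hqr, hqu, hru, rfl⟩ := ncard_eq_three.1 hcard
    subst hBt
    simp only [mem_insert_iff, mem_singleton_iff, not_or] at hpt
    have h₁ := htriple p (by simp) q (by simp) r (by simp) hpt.1 hpt.2.1 hqr
    have h₂ := htriple p (by simp) q (by simp) u (by simp) hpt.1 hpt.2.2 hqu
    have h₃ := htriple p (by simp) r (by simp) u (by simp) hpt.2.1 hpt.2.2 hru
    have h₄ := htriple q (by simp) r (by simp) u (by simp) hqr hqu hru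
    omega
  · obtain rfl : i = 0 := eq_zero_of_ne_one hi
    have hB : B ∈ omegaCovers X := hB
    refine exists_selector hO hB idx sel (fun V hVB => hsel V (hBA hVB))
      (fun V hVB => (hV V (hBA hVB)).subset.trans inter_subset_right) fun V hVB W hWB hVW => ?_
    by_contra hne
    have hVW' : V ≠ W := fun e => hne (e ▸ rfl)
    obtain ⟨Z, hZB, hZ⟩ := exists_lt_idx hw hB idx
      (fun V hVB => (hV V (hBA hVB)).subset.trans inter_subset_left) (idx V)
    have hVZ : V ≠ Z := by rintro rfl; exact lt_irrefl _ hZ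
    have hWZ : W ≠ Z := by rintro rfl; exact absurd hVW (ne_of_lt hZ)
    have := hf ⟨_, triple_mem_cardSubsets (hBA hVB) (hBA hWB) (hBA hZB) hVW' hVZ hWZ⟩
      (by simp [insert_subset_iff, hVB, hWB, hZB])
    rw [if_pos ⟨V, by simp, W, by simp, Z, by simp, hVW', hVW, hZ⟩] at this
    exact absurd this (by decide)

/-- Two levels of strata let each missing colour be exploited. Pairs are coloured by whether `i`
differs (`0`), only `j` differs (`1`), or both agree (`2`). Without `0`, everything lies in one
outer stratum, which is impossible. Without `1`, `i` determines `j`, so `u i j ∈ O i` is a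
selection. Without `2`, `(i, j)` determines the member, so `sel` selects from `O (Nat.pair i j)`. -/
theorem S1_of_squareArrow (h : SquareArrow (omegaCovers X) (omegaCovers X) 2 3 2) :
    S1 (omegaCovers X) (omegaCovers X) := by
  classical
  intro O hO
  choose u _ huO hu using fun n => exists_enumerated_subcover hX (hO n)
  let Q : ℕ → Set (Set X) := fun n => stratifiedCover (u n) fun k => O (Nat.pair n k)
  have hQ : ∀ n, Q n ∈ omegaCovers X := fun n => stratifiedCover_mem (hu n) fun k => hO _
  have hrep : ∀ V ∈ stratifiedCover (u 0) Q, ∃ n k, ∃ U ∈ O (Nat.pair n k),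
      V = u 0 n ∩ (u n k ∩ U) := by
    rintro V ⟨n, _, ⟨k, U, hU, rfl⟩, hV⟩
    exact ⟨n, k, U, hU, hV⟩
  choose! i j sel hsel hV using hrep
  obtain ⟨B, hBA, hB, hf⟩ := h _ (stratifiedCover_mem (hu 0) hQ)
    (fun s => if ∀ V ∈ s.1, ∀ W ∈ s.1, i V = i W then
      (if ∀ V ∈ s.1, ∀ W ∈ s.1, j V = j W then 2 else 1) else 0)
  obtain ⟨c, hc⟩ : ∃ c : Fin 3, c ∉ (fun s : cardSubsets (stratifiedCover (u 0) Q) 2 =>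
      if ∀ V ∈ s.1, ∀ W ∈ s.1, i V = i W then
      (if ∀ V ∈ s.1, ∀ W ∈ s.1, j V = j W then (2 : Fin 3) else 1) else 0) ''
        {s | ((s : Finset (Set X)) : Set (Set X)) ⊆ B} := by
    -- If all three colours occurred, the image would have three elements, against the bound of two.
    by_contra! hall
    rw [eq_univ_of_forall hall, ncard_univ, Nat.card_eq_fintype_card, Fintype.card_fin] at hf
    omega
  have hpair : ∀ V ∈ B, ∀ W ∈ B, V ≠ W →
      (if i V = i W then (if j V = j W then (2 : Fin 3) else 1) else 0) ≠ c := by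
    rintro V hVB W hWB hne rfl
    refine hc ⟨⟨_, pair_mem_cardSubsets (hBA hVB) (hBA hWB) hne⟩,
      by simp [insert_subset_iff, hVB, hWB], ?_⟩
    simp only [forall_mem_pair_eq_iff]
  fin_cases c
  · have hconst : ∀ V ∈ B, ∀ W ∈ B, i V = i W := by
      intro V hVB W hWB
      by_contra hne
      exact hpair V hVB W hWB (fun e => hne (e ▸ rfl)) (if_neg hne)
    obtain ⟨V, hVB, -⟩ := hB.2.2 ∅ finite_empty
    obtain ⟨W, hWB, hlt⟩ := exists_lt_idx (hu 0) hB i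
      (fun V hVB => (hV V (hBA hVB)).subset.trans inter_subset_left) (i V)
    exact absurd (hconst V hVB W hWB) (ne_of_lt hlt)
  · refine exists_selector hO hB i (fun V => u (i V) (j V))
      (fun V _ => huO _ (mem_range_self _)) (fun V hVB => ?_) fun V hVB W hWB hVW => ?_
    · exact (hV V (hBA hVB)).subset.trans (inter_subset_right.trans inter_subset_left)
    · have hj : j V = j W := by
        by_contra hne
        refine hpair V hVB W hWB (fun e => hne (e ▸ rfl)) ?_
        rw [if_pos hVW, if_neg hne]
        rfl
      simp only [hVW, hj]
  · refine exists_selector hO hB (fun V => Nat.pair (i V) (j V)) sel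
      (fun V hVB => hsel V (hBA hVB)) (fun V hVB => ?_) fun V hVB W hWB hVW => ?_
    · exact (hV V (hBA hVB)).subset.trans (inter_subset_right.trans inter_subset_right)
    · obtain ⟨hi, hj⟩ := Nat.pair_eq_pair.1 hVW
      by_contra hne
      refine hpair V hVB W hWB (fun e => hne (e ▸ rfl)) ?_
      rw [if_pos hi, if_pos hj]
      rfl

end Converse

end RamseyCovers

theorem mainTheorem1 (X : Type*) [TopologicalSpace X] [T2Space X]
    (hX : ∀ 𝒰 ∈ omegaCovers X, ∃ 𝒱 ⊆ 𝒰, 𝒱.Countable ∧ 𝒱 ∈ omegaCovers X) :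
    List.TFAE
      [ S1 (omegaCovers X) (omegaCovers X),
        EllentuckStatement (omegaCovers X) (omegaCovers X),
        GalvinPrikryStatement (omegaCovers X) (omegaCovers X),
        GalvinStatement (omegaCovers X) (omegaCovers X),
        NashWilliamsStatement (omegaCovers X) (omegaCovers X),
        ∀ n k : ℕ, 1 ≤ n → 1 ≤ k → Arrow (omegaCovers X) (fun _ : Fin k => omegaCovers X) n,
        ∀ n k : ℕ, 1 ≤ n → 1 ≤ k → SquareArrow (omegaCovers X) (omegaCovers X) n k 2,
        SquareArrow (omegaCovers X) (omegaCovers X) 2 3 2,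
        Arrow (omegaCovers X) ![omegaCovers X, setsOfCard (Set X) 4] 3,
        Arrow (omegaCovers X) ![omegaCovers X, omegaCovers X] 2,
        Arrow (omegaCovers X) ![omegaCovers X, openCovers X] 2 ] := by
  tfae_have 1 → 2 := S1.ellentuck
  tfae_have 2 → 3 := EllentuckStatement.galvinPrikry
  tfae_have 3 → 4 := GalvinPrikryStatement.galvin
  tfae_have 3 → 5 := GalvinPrikryStatement.nashWilliams
  tfae_have 4 → 10 := GalvinStatement.arrow_two hX
  tfae_have 10 → 11 := omegaCovers_arrow_openCovers
  tfae_have 11 → 1 := S1_of_arrow_openCovers hX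
  tfae_have 5 → 6 := fun h n k _ hk => NashWilliamsStatement.arrow hX h n k hk
  tfae_have 6 → 7 := fun h n k hn hk => omegaCovers_squareArrow (h n k hn hk)
  tfae_have 7 → 8 := fun h => h 2 3 (by norm_num) (by norm_num)
  tfae_have 8 → 1 := S1_of_squareArrow hX
  tfae_have 6 → 9 := omegaCovers_arrow_three
  tfae_have 9 → 1 := S1_of_arrow_four hX
  tfae_finish
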